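/- Let $X_1,X_2,\dots$ be independent, identically distributed real random variables such that $X_1$ is non-degenerate (not almost surely equal to a constant). Put $S_0=0$ and $S_n=X_1+\cdots+X_n$. For $n\ge 0$ let $L_{n,n}$ and $L_{n,0}$ be the largest, respectively the smallest, index $k\in\{0,\dots,n\}$ with $S_k=\max_{0\le j\le n}S_j$, and let $N_n$ and $N_n^+$ be the numbers of indices $i\in\{1,\dots,n\}$ with $S_i\ge 0$, respectively $S_i>0$. For $\rho\in(0,1]$ and $0\le y<1$ put $$C_\rho(y)=\exp\Big\{\sum_{k=1}^\infty\frac{y^k}{k}\big(P(S_k\ge 0)-\rho\big)\Big\},\qquad \hat C_\rho(y)=\exp\Big\{\sum_{k=1}^\infty\frac{y^k}{k}\big(P(S_k>0)-\rho\big)\Big\}.$$ Then, for every $n\ge 0$, $$P(L_{n,n}=n)=P(N_n=n),\qquad P(L_{n,0}=n)=P(N_n^+=n).$$ If $P(S_n\ge 0)\to\rho$ as $n\to\infty$ for some $0<\rho\le 1$, then, as $n\to\infty$, $$P(L_{n,n}=n)=P(N_n=n)\sim\frac{1}{\Gamma(\rho)}\,n^{\rho-1}C_\rho(1-1/n),$$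 $$P(L_{n,0}=n)=P(N_n^+=n)\sim\frac{1}{\Gamma(\rho)}\,n^{\rho-1}\hat C_\rho(1-1/n).$$ Moreover, if $\sum_{k=1}^\infty\frac1k P(S_k<0)<\infty$, then also $\sum_{k=1}^\infty\frac1k P(S_k\le 0)<\infty$, and $$\lim_{n\to\infty}P(L_{n,n}=n)=\lim_{n\to\infty}P(N_n=n)=\exp\Big[-\sum_{k=1}^\infty\frac1k P(S_k<0)\Big],$$ $$\lim_{n\to\infty}P(L_{n,0}=n)=\lim_{n\to\infty}P(N_n^+=n)=\exp\Big[-\sum_{k=1}^\infty\frac1k P(S_k\le 0)\Big].$$ -/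

import Mathlib

namespace RecordWalk

/-- The random walk `S_n = X_1 + ⋯ + X_n`, `S_0 = 0`; the step `X_{i+1}` is `X i`. -/
def walk {Ω : Type*} (X : ℕ → Ω → ℝ) (n : ℕ) (ω : Ω) : ℝ :=
  ∑ i ∈ Finset.range n, X i ω

/-- The positions `k ∈ {0, …, n}` at which the path `s_0, …, s_n` attains its maximum
(a nonempty finite set). -/
def maxPositions (s : ℕ → ℝ) (n : ℕ) : Set ℕ :=
  {k | k ≤ n ∧ ∀ j ≤ n, s j ≤ s k}

/-- `L_{n,n}`: the position of the last maximum among `S_0, …, S_n`. -/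
noncomputable def lastMaxPos {Ω : Type*} (X : ℕ → Ω → ℝ) (n : ℕ) (ω : Ω) : ℕ :=
  sSup (maxPositions (fun k => walk X k ω) n)

/-- `L_{n,0}`: the position of the first maximum among `S_0, …, S_n`. -/
noncomputable def firstMaxPos {Ω : Type*} (X : ℕ → Ω → ℝ) (n : ℕ) (ω : Ω) : ℕ :=
  sInf (maxPositions (fun k => walk X k ω) n)

/-- `N_n`: the number of `i ∈ {1, …, n}` with `S_i ≥ 0`. -/
noncomputable def numNonneg {Ω : Type*} (X : ℕ → Ω → ℝ) (n : ℕ) (ω : Ω) : ℕ :=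
  ((Finset.Icc 1 n).filter (fun i => 0 ≤ walk X i ω)).card

/-- `N_n^+`: the number of `i ∈ {1, …, n}` with `S_i > 0`. -/
noncomputable def numPos {Ω : Type*} (X : ℕ → Ω → ℝ) (n : ℕ) (ω : Ω) : ℕ :=
  ((Finset.Icc 1 n).filter (fun i => 0 < walk X i ω)).card

/-- `C_ρ(y) = exp (∑_{k ≥ 1} y^k / k * (P(S_k ≥ 0) - ρ))`, used for `0 ≤ y < 1`, where the
series converges absolutely. -/
noncomputable def weakC {Ω : Type*} [MeasurableSpace Ω] (P : MeasureTheory.Measure Ω)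
    (X : ℕ → Ω → ℝ) (ρ y : ℝ) : ℝ :=
  Real.exp (∑' k : ℕ, y ^ (k + 1) / ((k : ℝ) + 1) *
    (P.real {ω | 0 ≤ walk X (k + 1) ω} - ρ))

/-- `Ĉ_ρ(y) = exp (∑_{k ≥ 1} y^k / k * (P(S_k > 0) - ρ))`, used for `0 ≤ y < 1`, where the
series converges absolutely. -/
noncomputable def strictC {Ω : Type*} [MeasurableSpace Ω] (P : MeasureTheory.Measure Ω)
    (X : ℕ → Ω → ℝ) (ρ y : ℝ) : ℝ :=
  Real.exp (∑' k : ℕ, y ^ (k + 1) / ((k : ℝ) + 1) *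
    (P.real {ω | 0 < walk X (k + 1) ω} - ρ))

end RecordWalk

open MeasureTheory ProbabilityTheory Set Filter Topology

namespace RecordWalk

/-! Only the law of the step sequence matters, so everything is proved for the product measure
`iidLaw ν`. The weak and the strict case are treated together through a set `H`, either `Ici 0` or
`Ioi 0`.

Let u_n be the probability that S_n - S_j lies in `H` for all j < n. For the two choices of `H` this
is the probability that the last, respectively first, maximum is at n. Reversing the first n steps
shows that u_n is also the probability that S_1, ..., S_n all lie in `H`; this gives the two
identities and the monotonicity of u.

With f_j the probability that `H` is first entered at time j + 1, cutting at first entry gives U = 1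
+ FU for the generating functions. A cyclic rotation argument identifies the series A of a_k =
P(S_{k+1} ∈ H) as F'U. Hence U' = AU, which is Sparre Andersen's recursion (`sparreAndersen`), and U
is the exponential of the integral of A (`tsum_mul_pow_eq_exp`).

If a_k → ρ, the recursion itself gives n u_n / (u_0 + ... + u_{n-1}) → ρ. The partial sums then vary
regularly with index ρ, and an Abelian theorem compares them with U(1 - 1/n) = n^ρ C_ρ(1 - 1/n). If
the sum of (1 - a_k)/(k + 1) converges, Abel's theorem applied to (1 - s)U(s) identifies the limit
of u.

Passing from the weak to the strict case needs that P(S_k = 0)/k is summable and that P(S_n = 0) →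
0. The first comes from bounding the quotient of the weak and strict generating functions, the
second from the first by symmetrization. -/

/-! ### Independence and reindexing under the product law -/

lemma indepFun_comp_of_disjoint_range {ι α β : Type*} (ν : Measure ℝ) [IsProbabilityMeasure ν]
    (σ : α → ι) (τ : β → ι) (h : Disjoint (range σ) (range τ)) :
    IndepFun (fun (x : ι → ℝ) a => x (σ a)) (fun (x : ι → ℝ) b => x (τ b))
      (Measure.infinitePi fun _ : ι => ν) := by
  have hi : iIndepFun (fun (i : ι) (x : ι → ℝ) => x i) (Measure.infinitePi fun _ : ι => ν) :=
    iIndepFun_infinitePi (X := fun _ y => y) (fun _ => measurable_id)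
  have key := indep_iSup_of_disjoint (fun i => (measurable_pi_apply i).comap_le) hi.iIndep h
  refine indep_of_indep_of_le_left (indep_of_indep_of_le_right key ?_) ?_
  · rw [MeasurableSpace.pi, MeasurableSpace.comap_iSup]
    refine iSup_le fun b => ?_
    rw [MeasurableSpace.comap_comp]
    exact le_iSup₂_of_le (τ b) (mem_range_self b) le_rfl
  · rw [MeasurableSpace.pi, MeasurableSpace.comap_iSup]
    refine iSup_le fun b => ?_
    rw [MeasurableSpace.comap_comp]
    exact le_iSup₂_of_le (σ b) (mem_range_self b) le_rfl

lemma IndepFun.real_inter_preimage {Ω α β : Type*} {_ : MeasurableSpace Ω} {_ : MeasurableSpace α}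
    {_ : MeasurableSpace β} {μ : Measure Ω} {f : Ω → α} {g : Ω → β} (h : IndepFun f g μ)
    {s : Set α} {t : Set β} (hs : MeasurableSet s) (ht : MeasurableSet t) :
    μ.real (f ⁻¹' s ∩ g ⁻¹' t) = μ.real (f ⁻¹' s) * μ.real (g ⁻¹' t) := by
  simp only [Measure.real]
  rw [h.measure_inter_preimage_eq_mul s t hs ht, ENNReal.toReal_mul]

/-- The law of a sequence of independent real random variables with common law `ν`. -/
noncomputable abbrev iidLaw (ν : Measure ℝ) [IsProbabilityMeasure ν] : Measure (ℕ → ℝ) :=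
  Measure.infinitePi fun _ : ℕ => ν

lemma map_reindex_infinitePi {ι α : Type*} (ν : Measure ℝ) [IsProbabilityMeasure ν]
    {σ : α → ι} (hσ : σ.Injective) :
    (Measure.infinitePi fun _ : ι => ν).map (fun x a => x (σ a)) =
      Measure.infinitePi fun _ : α => ν :=
  Measure.map_infinitePi_infinitePi_of_inj hσ

lemma iidLaw_reindex (ν : Measure ℝ) [IsProbabilityMeasure ν] {σ : ℕ → ℕ} (hσ : σ.Injective)
    {A : Set (ℕ → ℝ)} (hA : MeasurableSet A) :
    (iidLaw ν).real {x | (fun i => x (σ i)) ∈ A} = (iidLaw ν).real A := by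
  have := map_reindex_infinitePi ν hσ
  conv_rhs => rw [iidLaw, ← this]
  rw [map_measureReal_apply (by fun_prop) hA]
  rfl

lemma iidLaw_inter_shift (ν : Measure ℝ) [IsProbabilityMeasure ν] {k : ℕ} {A B : Set (ℕ → ℝ)}
    (hA : MeasurableSet A) (hB : MeasurableSet B)
    (hdep : ∀ x y : ℕ → ℝ, (∀ i < k, x i = y i) → x ∈ A → y ∈ A) :
    (iidLaw ν).real (A ∩ {x | (fun i => x (i + k)) ∈ B}) =
      (iidLaw ν).real A * (iidLaw ν).real B := by
  have hind := indepFun_comp_of_disjoint_range ν (fun i : Fin k => (i : ℕ)) (fun i : ℕ => i + k)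
    (by
      rw [Set.disjoint_left]
      rintro _ ⟨a, rfl⟩ ⟨b, hb⟩
      have := a.2
      simp only at hb
      omega)
  -- Padding by 0 is harmless: membership in `A` is decided by the first `k` coordinates.
  let g : (Fin k → ℝ) → ℕ → ℝ := fun y i => if h : i < k then y ⟨i, h⟩ else 0
  have hg : Measurable g := by
    rw [measurable_pi_iff]
    intro i
    by_cases h : i < k
    · simp only [g, h, dite_true]; fun_prop
    · simp only [g, h, dite_false]; fun_prop
  have h1 : {x : ℕ → ℝ | (fun i : Fin k => x i) ∈ g ⁻¹' A} = A := by
    ext x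
    constructor
    · intro hx
      exact hdep _ _ (fun i hi => by simp [g, hi]) hx
    · intro hx
      exact hdep _ _ (fun i hi => by simp [g, hi]) hx
  have h2 := IndepFun.real_inter_preimage hind (hg hA) hB
  change (iidLaw ν).real ({x : ℕ → ℝ | (fun i : Fin k => x i) ∈ g ⁻¹' A} ∩ _) =
    (iidLaw ν).real {x : ℕ → ℝ | (fun i : Fin k => x i) ∈ g ⁻¹' A} *
     (iidLaw ν).real {x | (fun i => x (i + k)) ∈ B} at h2
  rw [h1, iidLaw_reindex ν (add_left_injective k) hB] at h2
  exact h2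

/-! ### Half-lines, partial sums and ladder events -/

/-- A measurable set of reals which is closed under addition together with its complement. -/
structure IsHalfLine (H : Set ℝ) : Prop where
  measurableSet : MeasurableSet H
  add_mem : ∀ {a b : ℝ}, a ∈ H → b ∈ H → a + b ∈ H
  add_notMem : ∀ {a b : ℝ}, a ∉ H → b ∉ H → a + b ∉ H

lemma isHalfLine_Ici : IsHalfLine (Ici 0) where
  measurableSet := measurableSet_Ici
  add_mem := by simp only [mem_Ici]; intros; positivity
  add_notMem := by simp only [mem_Ici, not_le]; intros; linarith

lemma isHalfLine_Ioi : IsHalfLine (Ioi 0) where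
  measurableSet := measurableSet_Ioi
  add_mem := by simp only [mem_Ioi]; intros; positivity
  add_notMem := by simp only [mem_Ioi, not_lt]; intros; linarith

/-- The partial sums of a sequence. -/
def psum (x : ℕ → ℝ) (n : ℕ) : ℝ := ∑ i ∈ Finset.range n, x i

@[simp] lemma psum_zero (x : ℕ → ℝ) : psum x 0 = 0 := rfl

lemma psum_succ (x : ℕ → ℝ) (n : ℕ) : psum x (n + 1) = psum x n + x n :=
  Finset.sum_range_succ _ _

@[fun_prop]
lemma measurable_psum (n : ℕ) : Measurable fun x => psum x n := by
  unfold psum; fun_prop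

lemma psum_congr {x y : ℕ → ℝ} {n : ℕ} (h : ∀ i < n, x i = y i) : psum x n = psum y n :=
  Finset.sum_congr rfl fun i hi => h i (Finset.mem_range.1 hi)

lemma psum_shift (x : ℕ → ℝ) (k j : ℕ) :
    psum (fun i => x (i + k)) j = psum x (k + j) - psum x k := by
  unfold psum
  rw [Finset.sum_range_add]
  simp [add_comm]

/-- The sequences whose `n`-th partial sum exceeds (in the sense of `H`) all the previous ones. -/
def ladderAt (H : Set ℝ) (n : ℕ) : Set (ℕ → ℝ) := {x | ∀ j < n, psum x n - psum x j ∈ H}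

/-- The sequences whose partial sums up to time `k` avoid `H`. -/
def avoidUpTo (H : Set ℝ) (k : ℕ) : Set (ℕ → ℝ) := {x | ∀ j, 1 ≤ j → j ≤ k → psum x j ∉ H}

/-- The sequences whose partial sums up to time `n` lie in `H`. -/
def stayUpTo (H : Set ℝ) (n : ℕ) : Set (ℕ → ℝ) := {x | ∀ j, 1 ≤ j → j ≤ n → psum x j ∈ H}

/-- The sequences whose partial sums enter `H` for the first time at time `k + 1`. -/
def entryAt (H : Set ℝ) (k : ℕ) : Set (ℕ → ℝ) := avoidUpTo H k ∩ {x | psum x (k + 1) ∈ H}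

section measurability

variable {H : Set ℝ} (hH : MeasurableSet H)
include hH

lemma measurableSet_psum_mem (n : ℕ) : MeasurableSet {x | psum x n ∈ H} :=
  measurable_psum n hH

lemma measurableSet_psum_sub_mem (n j : ℕ) : MeasurableSet {x | psum x n - psum x j ∈ H} :=
  ((measurable_psum n).sub (measurable_psum j)) hH

lemma measurableSet_ladderAt (n : ℕ) : MeasurableSet (ladderAt H n) := by
  have : ladderAt H n = ⋂ j, ⋂ _ : j < n, {x | psum x n - psum x j ∈ H} := by
    ext; simp [ladderAt]
  rw [this]
  exact .iInter fun j => .iInter fun _ => measurableSet_psum_sub_mem hH n j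

lemma measurableSet_avoidUpTo (n : ℕ) : MeasurableSet (avoidUpTo H n) := by
  have : avoidUpTo H n = ⋂ j, ⋂ _ : 1 ≤ j, ⋂ _ : j ≤ n, {x | psum x j ∈ H}ᶜ := by
    ext; simp [avoidUpTo]
  rw [this]
  exact .iInter fun j => .iInter fun _ => .iInter fun _ => (measurableSet_psum_mem hH j).compl

lemma measurableSet_stayUpTo (n : ℕ) : MeasurableSet (stayUpTo H n) := by
  have : stayUpTo H n = ⋂ j, ⋂ _ : 1 ≤ j, ⋂ _ : j ≤ n, {x | psum x j ∈ H} := by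
    ext; simp [stayUpTo]
  rw [this]
  exact .iInter fun j => .iInter fun _ => .iInter fun _ => measurableSet_psum_mem hH j

lemma measurableSet_entryAt (n : ℕ) : MeasurableSet (entryAt H n) :=
  (measurableSet_avoidUpTo hH n).inter (measurableSet_psum_mem hH _)

end measurability

/-! ### First entries and top indices of a path -/

section combinatorics

variable {H : Set ℝ} (hH : IsHalfLine H)
include hH

lemma IsHalfLine.sub_mem_of_notMem {a b : ℝ} (ha : a ∈ H) (hb : b ∉ H) : a - b ∈ H := by
  by_contra h
  exact hH.add_notMem hb h (by simpa using ha)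

/-- At a first entry into `H` the sum S_{k+1} already exceeds all earlier ones, since they avoid `H`
or are S_0. Exceeding S_{k+1} then implies exceeding those, so only the later steps impose a
condition. -/
lemma ladderAt_inter_entryAt (k d : ℕ) :
    ladderAt H (k + 1 + d) ∩ entryAt H k =
      entryAt H k ∩ {x | (fun i => x (i + (k + 1))) ∈ ladderAt H d} := by
  ext x
  simp only [mem_inter_iff, mem_ofPred_eq, and_comm (b := x ∈ entryAt H k), ladderAt, psum_shift]
  refine and_congr_right fun hx => ⟨fun h j hj => ?_, fun h j hj => ?_⟩
  · have := h (k + 1 + j) (by omega)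
    convert this using 1
    ring
  · have h0 : ∀ j, j < k + 1 → psum x (k + 1) - psum x j ∈ H := by
      intro j hj
      rcases Nat.eq_zero_or_pos j with rfl | hj0
      · simpa using hx.2
      · exact hH.sub_mem_of_notMem hx.2 (hx.1 j hj0 (by omega))
    by_cases hjk : j < k + 1
    · rcases Nat.eq_zero_or_pos d with rfl | hd
      · exact h0 j hjk
      · have := hH.add_mem (h 0 hd) (h0 j hjk)
        convert this using 1
        simp
    · have := h (j - (k + 1)) (by omega)
      rw [show k + 1 + (j - (k + 1)) = j by omega] at this
      convert this using 1
      ring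

/-- The index `i` carries the largest (in the sense of `H`) of the partial sums `1, …, n`. -/
def IsTop (H : Set ℝ) (n i : ℕ) (x : ℕ → ℝ) : Prop :=
  (∀ j, 1 ≤ j → j < i → psum x i - psum x j ∈ H) ∧ ∀ m, i < m → m ≤ n → psum x m - psum x i ∉ H

/-- The top is the last maximum over the times 1, ..., n + 1 for `Ici 0` and the first for `Ioi 0`.
A new partial sum either replaces the current top or leaves it unchanged. -/
lemma exists_isTop (x : ℕ → ℝ) (n : ℕ) : ∃ i, 1 ≤ i ∧ i ≤ n + 1 ∧ IsTop H (n + 1) i x := by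
  induction n with
  | zero => exact ⟨1, le_rfl, le_rfl, fun j _ _ => by omega, fun m _ _ => by omega⟩
  | succ n ih =>
    obtain ⟨i, hi1, hin, h1, h2⟩ := ih
    by_cases h : psum x (n + 2) - psum x i ∈ H
    · refine ⟨n + 2, by omega, le_rfl, fun j hj1 hjn => ?_, fun m _ _ => by omega⟩
      rcases lt_trichotomy j i with hji | rfl | hji
      · simpa using hH.add_mem h (h1 j hj1 hji)
      · exact h
      · simpa using hH.sub_mem_of_notMem h (h2 j hji (by omega))
    · refine ⟨i, hi1, by omega, h1, fun m hm hmn => ?_⟩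
      rcases Nat.lt_or_ge (n + 1) m with h' | h'
      · obtain rfl : m = n + 2 := by omega
        exact h
      · exact h2 m hm h'

omit hH in
lemma IsTop.eq {x : ℕ → ℝ} {n i j : ℕ} (hi : IsTop H n i x) (hj : IsTop H n j x) (hi1 : 1 ≤ i)
    (hj1 : 1 ≤ j) (hin : i ≤ n) (hjn : j ≤ n) : i = j := by
  rcases lt_trichotomy i j with h | h | h
  · exact absurd (hj.1 i hi1 h) (hi.2 j h hjn)
  · exact h
  · exact absurd (hi.1 j hj1 h) (hj.2 i h hin)

end combinatorics

/-! ### Cyclic rotation of the steps -/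

/-- The rotation of the first `n` indices by `i`. -/
def rotIndex (n i j : ℕ) : ℕ := if j < n then (j + i) % n else j

lemma rotIndex_injective (n i : ℕ) : (rotIndex n i).Injective := by
  intro a b h
  unfold rotIndex at h
  split_ifs at h with ha hb hb
  · have := Nat.ModEq.add_right_cancel' i h
    rwa [Nat.ModEq, Nat.mod_eq_of_lt ha, Nat.mod_eq_of_lt hb] at this
  · have := Nat.mod_lt (a + i) (by omega : n > 0)
    omega
  · have := Nat.mod_lt (b + i) (by omega : n > 0)
    omega
  · exact h

lemma psum_rotIndex_of_le (x : ℕ → ℝ) {n i j : ℕ} (hj : i + j ≤ n) :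
    psum (fun l => x (rotIndex n i l)) j = psum x (i + j) - psum x i := by
  rw [← psum_shift]
  refine psum_congr fun l hl => ?_
  rcases Nat.lt_or_ge l n with h | h
  · rw [rotIndex, if_pos h, Nat.mod_eq_of_lt (by omega)]
  · omega

lemma psum_rotIndex_add (x : ℕ → ℝ) {n i j : ℕ} (hi : i ≤ n) (hj : j ≤ i) :
    psum (fun l => x (rotIndex n i l)) (n - i + j) = psum x n - psum x i + psum x j := by
  have h := psum_shift (fun l => x (rotIndex n i l)) (n - i) j
  have h2 : psum (fun l => x (rotIndex n i (l + (n - i)))) j = psum x j := by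
    refine psum_congr fun l hl => ?_
    rw [rotIndex, if_pos (by omega), show l + (n - i) + i = l + n by omega, Nat.add_mod_right,
      Nat.mod_eq_of_lt (by omega)]
  rw [h2, psum_rotIndex_of_le x (j := n - i) (by omega), show i + (n - i) = n by omega] at h
  linarith

/-- The rotated path runs through S_{i+j} - S_i up to time n - i, then through S_n - S_i + S_j.
Avoiding `H` on the first stretch is the later half of `IsTop`; the ladder condition on the second
is its earlier half. On the first stretch the ladder condition is automatic once S_n ∈ H. -/
lemma mem_ladderAt_rotIndex_iff {H : Set ℝ} (hH : IsHalfLine H) (x : ℕ → ℝ) {n i : ℕ}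
    (hi : 1 ≤ i) (hin : i ≤ n) :
    (fun l => x (rotIndex n i l)) ∈ ladderAt H n ∩ avoidUpTo H (n - i) ↔
      psum x n ∈ H ∧ IsTop H n i x := by
  have hn : psum (fun l => x (rotIndex n i l)) n = psum x n := by
    have := psum_rotIndex_add x hin le_rfl
    rw [show n - i + i = n by omega] at this
    linarith
  simp only [mem_inter_iff, ladderAt, avoidUpTo, mem_ofPred_eq, hn]
  constructor
  · rintro ⟨h1, h2⟩
    refine ⟨by simpa using h1 0 (by omega), fun j hj hji => ?_, fun m hm hmn => ?_⟩
    · have := h1 (n - i + j) (by omega)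
      rw [psum_rotIndex_add x hin (by omega)] at this
      convert this using 1
      ring
    · have := h2 (m - i) (by omega) (by omega)
      rwa [psum_rotIndex_of_le x (by omega), show i + (m - i) = m by omega] at this
  · rintro ⟨h0, h1, h2⟩
    refine ⟨fun j hj => ?_, fun j hj hjn => ?_⟩
    · rcases Nat.lt_or_ge (n - i) j with h | h
      · obtain ⟨l, rfl⟩ : ∃ l, j = n - i + l := ⟨j - (n - i), by omega⟩
        rw [psum_rotIndex_add x hin (by omega)]
        have := h1 l (by omega) (by omega)
        convert this using 1
        ring
      · rw [psum_rotIndex_of_le x (by omega)]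
        rcases Nat.eq_zero_or_pos j with rfl | hj0
        · simpa using h0
        · exact hH.sub_mem_of_notMem h0 (h2 (i + j) (by omega) (by omega))
    · rw [psum_rotIndex_of_le x (by omega)]
      exact h2 _ (by omega) (by omega)

/-! ### Renewal equations and Sparre Andersen's recursion -/

section recursion

variable (ν : Measure ℝ) [IsProbabilityMeasure ν] {H : Set ℝ}

lemma entryAt_dep (H : Set ℝ) (k : ℕ) (x y : ℕ → ℝ) (h : ∀ i < k + 1, x i = y i)
    (hx : x ∈ entryAt H k) : y ∈ entryAt H k := by
  refine ⟨fun j hj hjk => ?_, ?_⟩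
  · rw [← psum_congr fun i hi => h i (by omega)]
    exact hx.1 j hj hjk
  · have := hx.2
    rw [mem_ofPred_eq] at this ⊢
    rwa [← psum_congr h]

lemma real_ladderAt_inter_entryAt (hH : IsHalfLine H) (k d : ℕ) :
    (iidLaw ν).real (ladderAt H (k + 1 + d) ∩ entryAt H k) =
      (iidLaw ν).real (entryAt H k) * (iidLaw ν).real (ladderAt H d) := by
  rw [ladderAt_inter_entryAt hH, iidLaw_inter_shift ν (measurableSet_entryAt hH.measurableSet k)
    (measurableSet_ladderAt hH.measurableSet d) (entryAt_dep H k)]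

/-- A ladder time n + 1 has S_{n+1} ∈ H, so `H` is entered by then, at a time j + 1 with j ≥ k.
Descending in k splits off one entry time at each step. -/
lemma real_ladderAt_inter_avoidUpTo (hH : IsHalfLine H) (n k : ℕ) (hk : k ≤ n + 1) :
    (iidLaw ν).real (ladderAt H (n + 1) ∩ avoidUpTo H k) =
      ∑ j ∈ Finset.Ico k (n + 1), (iidLaw ν).real (entryAt H j) *
        (iidLaw ν).real (ladderAt H (n - j)) := by
  induction hk using Nat.decreasingInduction with
  | self =>
    rw [Finset.Ico_self, Finset.sum_empty]
    have : ladderAt H (n + 1) ∩ avoidUpTo H (n + 1) = ∅ := by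
      ext x
      simp only [mem_inter_iff, mem_empty_iff_false, iff_false, not_and]
      intro h1 h2
      exact h2 (n + 1) (by omega) le_rfl (by simpa using h1 0 (by omega))
    simp [this]
  | of_succ k hk ih =>
    rw [Finset.sum_eq_sum_Ico_succ_bot hk, ← ih]
    obtain ⟨d, rfl⟩ : ∃ d, n = k + d := ⟨n - k, by omega⟩
    rw [show k + d - k = d by omega, ← real_ladderAt_inter_entryAt ν hH,
      ← measureReal_inter_add_sdiff (s := ladderAt H (k + d + 1) ∩ avoidUpTo H k)
        (measurableSet_psum_mem hH.measurableSet (k + 1))]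
    congr 2
    · rw [inter_assoc, entryAt, show k + 1 + d = k + d + 1 by omega]
    · ext x
      simp only [Set.mem_sdiff, mem_inter_iff, mem_ofPred_eq, and_assoc, avoidUpTo]
      refine and_congr_right fun _ => ⟨fun h j hj hjk => ?_, fun h => ⟨fun j hj hjk =>
        h j hj (by omega), h (k + 1) (by omega) le_rfl⟩⟩
      rcases Nat.lt_or_ge k j with h' | h'
      · obtain rfl : j = k + 1 := by omega
        exact h.2
      · exact h.1 j hj h'

lemma real_ladderAt_succ (hH : IsHalfLine H) (n : ℕ) :
    (iidLaw ν).real (ladderAt H (n + 1)) =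
      ∑ j ∈ Finset.range (n + 1), (iidLaw ν).real (entryAt H j) *
        (iidLaw ν).real (ladderAt H (n - j)) := by
  rw [Finset.range_eq_Ico, ← real_ladderAt_inter_avoidUpTo ν hH n 0 (by omega)]
  congr 2
  ext x
  simp only [mem_inter_iff, iff_self_and]
  intro _ j _ _
  omega

/-- The event splits according to the unique top index n + 1 - k. Rotation turns each piece into a
ladder event avoiding `H` up to k, a tail sum over j ≥ k; on exchanging the sums, the term j is
counted j + 1 times. -/
lemma real_psum_mem_succ (hH : IsHalfLine H) (n : ℕ) :
    (iidLaw ν).real {x | psum x (n + 1) ∈ H} =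
      ∑ j ∈ Finset.range (n + 1), (j + 1 : ℝ) * (iidLaw ν).real (entryAt H j) *
        (iidLaw ν).real (ladderAt H (n - j)) := by
  have hrot : ∀ k ∈ Finset.range (n + 1),
      {x | psum x (n + 1) ∈ H ∧ IsTop H (n + 1) (n + 1 - k) x} =
      {x | (fun l => x (rotIndex (n + 1) (n + 1 - k) l)) ∈
        ladderAt H (n + 1) ∩ avoidUpTo H k} := by
    intro k hk
    have hk := Finset.mem_range.1 hk
    ext x
    have := mem_ladderAt_rotIndex_iff hH x (n := n + 1) (i := n + 1 - k) (by omega) (by omega)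
    rw [show n + 1 - (n + 1 - k) = k by omega] at this
    exact this.symm
  have hmeas : ∀ k, MeasurableSet (ladderAt H (n + 1) ∩ avoidUpTo H k) := fun k =>
    (measurableSet_ladderAt hH.measurableSet _).inter (measurableSet_avoidUpTo hH.measurableSet _)
  have hmr : ∀ i : ℕ, Measurable fun (x : ℕ → ℝ) l => x (rotIndex (n + 1) i l) := fun i => by
    fun_prop
  have hunion : {x | psum x (n + 1) ∈ H} = ⋃ k ∈ Finset.range (n + 1),
      {x | psum x (n + 1) ∈ H ∧ IsTop H (n + 1) (n + 1 - k) x} := by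
    ext x
    simp only [mem_ofPred_eq, mem_iUnion, exists_prop, Finset.mem_range]
    refine ⟨fun h => ?_, fun ⟨_, _, h, _⟩ => h⟩
    obtain ⟨i, hi1, hin, hi⟩ := exists_isTop hH x n
    refine ⟨n + 1 - i, by omega, h, ?_⟩
    rwa [show n + 1 - (n + 1 - i) = i by omega]
  rw [hunion, measureReal_biUnion_finset]
  · calc _ = ∑ k ∈ Finset.range (n + 1), ∑ j ∈ Finset.Ico k (n + 1),
          (iidLaw ν).real (entryAt H j) * (iidLaw ν).real (ladderAt H (n - j)) := by
          refine Finset.sum_congr rfl fun k hk => ?_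
          rw [hrot k hk, iidLaw_reindex ν (rotIndex_injective _ _) (hmeas k),
            real_ladderAt_inter_avoidUpTo ν hH n k (by have := Finset.mem_range.1 hk; omega)]
      _ = ∑ j ∈ Finset.range (n + 1), ∑ k ∈ Finset.range (j + 1),
          (iidLaw ν).real (entryAt H j) * (iidLaw ν).real (ladderAt H (n - j)) := by
          refine Finset.sum_comm' fun k j => ?_
          simp only [Finset.mem_range, Finset.mem_Ico]
          omega
      _ = _ := by
          refine Finset.sum_congr rfl fun j _ => ?_
          simp [mul_assoc]
  · intro a ha b hb hab
    have ha := Finset.mem_range.1 ha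
    have hb := Finset.mem_range.1 hb
    rw [Function.onFun, Set.disjoint_left]
    rintro x ⟨_, h1⟩ ⟨_, h2⟩
    have := h1.eq h2 (by omega) (by omega) (by omega) (by omega)
    omega
  · intro k hk
    rw [hrot k hk]
    exact hmr _ (hmeas k)

lemma real_ladderAt_zero (H : Set ℝ) : (iidLaw ν).real (ladderAt H 0) = 1 := by
  have : ladderAt H 0 = univ := by ext; simp [ladderAt]
  simp [this]

-- In formal power series, U = 1 + FU and A = F'U. Differentiating gives (1 - F)U' = F'U, and
-- multiplying by U, the inverse of 1 - F, gives U' = AU.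
open PowerSeries in
lemma mul_succ_eq_sum_of_renewal {u f a : ℕ → ℝ} (hu0 : u 0 = 1)
    (hu : ∀ n, u (n + 1) = ∑ j ∈ Finset.range (n + 1), f j * u (n - j))
    (ha : ∀ n, a n = ∑ j ∈ Finset.range (n + 1), (j + 1 : ℝ) * f j * u (n - j)) (n : ℕ) :
    (n + 1 : ℝ) * u (n + 1) = ∑ j ∈ Finset.range (n + 1), a j * u (n - j) := by
  let U : PowerSeries ℝ := PowerSeries.mk u
  let F : PowerSeries ℝ := X * PowerSeries.mk f
  let A : PowerSeries ℝ := PowerSeries.mk a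
  have hU : U = 1 + F * U := by
    ext n
    cases n with
    | zero => simp [U, F, hu0, mul_assoc]
    | succ n =>
      rw [map_add, mul_assoc X, mul_comm X, coeff_succ_mul_X, coeff_mul,
        Finset.Nat.sum_antidiagonal_eq_sum_range_succ_mk]
      simp [U, hu, coeff_one]
  have hA : A = d⁄dX ℝ F * U := by
    ext n
    rw [coeff_mul, Finset.Nat.sum_antidiagonal_eq_sum_range_succ_mk]
    simp only [A, coeff_mk, ha, U, F, coeff_derivative, mul_comm X, coeff_succ_mul_X]
    exact Finset.sum_congr rfl fun j _ => by ring
  have hd : d⁄dX ℝ U = A * U := by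
    have h1 : d⁄dX ℝ U = F * d⁄dX ℝ U + U * d⁄dX ℝ F := by
      conv_lhs => rw [hU]
      simp [Derivation.leibniz]
    rw [hA]
    linear_combination U * h1 - (d⁄dX ℝ U) * hU
  have := congrArg (coeff n) hd
  rw [coeff_mul, Finset.Nat.sum_antidiagonal_eq_sum_range_succ_mk, coeff_derivative] at this
  simp only [U, A, coeff_mk] at this
  linarith

/-- Sparre Andersen's recursion. -/
theorem sparreAndersen (hH : IsHalfLine H) (n : ℕ) :
    (n + 1 : ℝ) * (iidLaw ν).real (ladderAt H (n + 1)) =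
      ∑ j ∈ Finset.range (n + 1), (iidLaw ν).real {x | psum x (j + 1) ∈ H} *
        (iidLaw ν).real (ladderAt H (n - j)) :=
  mul_succ_eq_sum_of_renewal (u := fun n => (iidLaw ν).real (ladderAt H n))
    (f := fun n => (iidLaw ν).real (entryAt H n))
    (a := fun n => (iidLaw ν).real {x | psum x (n + 1) ∈ H}) (real_ladderAt_zero ν H)
    (real_ladderAt_succ ν hH) (real_psum_mem_succ ν hH) n

/-! ### Reversal of the steps -/

/-- The reversal of the first `n` indices. -/
def revIndex (n j : ℕ) : ℕ := if j < n then n - 1 - j else j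

lemma revIndex_injective (n : ℕ) : (revIndex n).Injective := by
  intro a b h
  unfold revIndex at h
  split_ifs at h <;> omega

lemma psum_revIndex (x : ℕ → ℝ) {n j : ℕ} (hj : j ≤ n) :
    psum (fun l => x (revIndex n l)) j = psum x n - psum x (n - j) := by
  induction j with
  | zero => simp
  | succ j ih =>
    rw [psum_succ, ih (by omega), revIndex, if_pos (by omega),
      show n - j = n - 1 - j + 1 by omega, psum_succ, show n - (j + 1) = n - 1 - j by omega]
    ring

theorem real_ladderAt_eq_real_stayUpTo (hH : MeasurableSet H) (n : ℕ) :
    (iidLaw ν).real (ladderAt H n) = (iidLaw ν).real (stayUpTo H n) := by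
  rw [← iidLaw_reindex ν (revIndex_injective n) (measurableSet_stayUpTo hH n)]
  congr 1
  ext x
  simp only [ladderAt, stayUpTo, mem_ofPred_eq]
  refine ⟨fun h j hj hjn => ?_, fun h j hj => ?_⟩
  · rw [psum_revIndex x hjn]
    exact h _ (by omega)
  · have := h (n - j) (by omega) (by omega)
    rwa [psum_revIndex x (by omega), show n - (n - j) = j by omega] at this

/-- The ladder events are not nested, but the equiprobable events `stayUpTo` are. -/
lemma antitone_real_ladderAt (hH : MeasurableSet H) :
    Antitone fun n => (iidLaw ν).real (ladderAt H n) := by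
  intro m n hmn
  simp only [real_ladderAt_eq_real_stayUpTo ν hH]
  exact measureReal_mono fun x hx j hj hjm => hx j hj (hjm.trans hmn)

end recursion

/-! ### The generating function in exponential form -/

section powerSeries

lemma summable_mul_pow_of_bounded {c : ℕ → ℝ} {C s : ℝ} (hc : ∀ n, |c n| ≤ C) (hs : |s| < 1) :
    Summable fun n => c n * s ^ n := by
  refine Summable.of_norm_bounded
    ((summable_geometric_of_lt_one (abs_nonneg s) hs).mul_left C) fun n => ?_
  rw [Real.norm_eq_abs, abs_mul, abs_pow]
  exact mul_le_mul_of_nonneg_right (hc n) (by positivity)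

lemma hasDerivAt_tsum_mul_pow {c : ℕ → ℝ} {C s : ℝ} (hc : ∀ n, |c n| ≤ C) (hs : |s| < 1) :
    HasDerivAt (fun y => ∑' n, c n * y ^ n) (∑' n : ℕ, (n + 1 : ℝ) * c (n + 1) * s ^ n) s := by
  obtain ⟨r, hsr, hr1⟩ := exists_between hs
  have hr0 : 0 ≤ r := (abs_nonneg s).trans hsr.le
  have hsum : Summable fun n : ℕ => C * ((n : ℝ) * r ^ (n - 1)) := by
    refine Summable.mul_left C ?_
    rw [← summable_nat_add_iff 1]
    have h1 : Summable fun n : ℕ => (n : ℝ) ^ 1 * r ^ n :=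
      summable_pow_mul_geometric_of_norm_lt_one 1 (by rwa [Real.norm_of_nonneg hr0])
    refine (h1.add (summable_geometric_of_lt_one hr0 hr1)).congr fun n => ?_
    push_cast
    simp
    ring
  have key := hasDerivAt_tsum_of_isPreconnected (g := fun n y => c n * y ^ n)
    (g' := fun (n : ℕ) y => c n * ((n : ℝ) * y ^ (n - 1))) (t := Metric.ball (0 : ℝ) r)
    hsum Metric.isOpen_ball (convex_ball (0 : ℝ) r).isPreconnected
    (fun n y _ => (hasDerivAt_pow n y).const_mul (c n))
    (fun n y hy => by
      rw [mem_ball_zero_iff, Real.norm_eq_abs] at hy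
      rw [Real.norm_eq_abs, abs_mul, abs_mul, abs_pow, Nat.abs_cast]
      have hC : 0 ≤ C := (abs_nonneg _).trans (hc 0)
      gcongr
      exact hc n)
    (y₀ := s) (by simpa using hsr) (summable_mul_pow_of_bounded hc hs) (y := s)
    (by simpa using hsr)
  convert! key using 1
  have hsum' : Summable fun n : ℕ => c n * ((n : ℝ) * s ^ (n - 1)) := by
    refine Summable.of_norm_bounded hsum fun n => ?_
    rw [Real.norm_eq_abs, abs_mul, abs_mul, abs_pow, Nat.abs_cast]
    have hC : 0 ≤ C := (abs_nonneg _).trans (hc 0)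
    gcongr
    exact hc n
  rw [hsum'.tsum_eq_zero_add]
  simp only [Nat.cast_zero, zero_mul, mul_zero, zero_add, Nat.cast_add, Nat.cast_one,
    Nat.add_sub_cancel]
  exact tsum_congr fun n => by ring

variable {u a : ℕ → ℝ} {C D : ℝ}

/-- A sequence satisfying Sparre Andersen's recursion has the generating function of Spitzer. -/
theorem tsum_mul_pow_eq_exp (hu0 : u 0 = 1) (hu : ∀ n, |u n| ≤ C) (ha : ∀ n, |a n| ≤ D)
    (hrec : ∀ n : ℕ, (n + 1 : ℝ) * u (n + 1) = ∑ j ∈ Finset.range (n + 1), a j * u (n - j))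
    {s : ℝ} (hs : |s| < 1) :
    ∑' n, u n * s ^ n = Real.exp (∑' k : ℕ, a k / (k + 1) * s ^ (k + 1)) := by
  let b : ℕ → ℝ := fun n => Nat.casesOn n 0 fun k => a k / (k + 1)
  have hD : 0 ≤ D := (abs_nonneg _).trans (ha 0)
  have hb : ∀ n, |b n| ≤ D := by
    rintro (_ | n)
    · simpa [b] using hD
    · simp only [b, abs_div]
      rw [abs_of_nonneg (by positivity : (0 : ℝ) ≤ n + 1)]
      exact (div_le_self (abs_nonneg _) (by linarith [(n.cast_nonneg : (0 : ℝ) ≤ n)])).trans (ha n)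
  have hbs : ∀ y : ℝ, |y| < 1 →
      ∑' n, b n * y ^ n = ∑' k : ℕ, a k / (k + 1) * y ^ (k + 1) := by
    intro y hy
    rw [(summable_mul_pow_of_bounded hb hy).tsum_eq_zero_add]
    simp [b]
  -- With B the series of `b`, the recursion says U' = AU while B' = A, so U exp(-B) is constant;
  -- its value at 0 is 1.
  have hderiv : ∀ y ∈ Metric.ball (0 : ℝ) 1, HasDerivAt
      (fun y => (∑' n, u n * y ^ n) * Real.exp (-∑' n, b n * y ^ n)) 0 y := by
    intro y hy
    rw [mem_ball_zero_iff, Real.norm_eq_abs] at hy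
    have h1 := hasDerivAt_tsum_mul_pow hu hy
    have h2 := (hasDerivAt_tsum_mul_pow hb hy).neg.exp
    convert! h1.mul h2 using 1
    have h3 : ∑' n : ℕ, (n + 1 : ℝ) * u (n + 1) * y ^ n =
        (∑' n, a n * y ^ n) * ∑' n, u n * y ^ n := by
      rw [tsum_mul_tsum_eq_tsum_sum_range_of_summable_norm
        (summable_mul_pow_of_bounded ha hy).norm (summable_mul_pow_of_bounded hu hy).norm]
      refine tsum_congr fun n => ?_
      rw [hrec, Finset.sum_mul]
      refine Finset.sum_congr rfl fun j hj => ?_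
      have hj := Finset.mem_range.1 hj
      rw [show y ^ n = y ^ j * y ^ (n - j) by rw [← pow_add]; congr 1; omega]
      ring
    have h4 : ∑' n : ℕ, (n + 1 : ℝ) * b (n + 1) * y ^ n = ∑' n, a n * y ^ n := by
      refine tsum_congr fun n => ?_
      have : (n + 1 : ℝ) ≠ 0 := by positivity
      simp only [b]
      field_simp
    rw [h3, h4]
    simp only [Pi.neg_apply]
    ring
  have hconst := Metric.isOpen_ball.is_const_of_deriv_eq_zero
    (convex_ball (0 : ℝ) 1).isPreconnected
    (fun y hy => (hderiv y hy).differentiableAt.differentiableWithinAt)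
    (fun y hy => (hderiv y hy).deriv)
    (show s ∈ Metric.ball (0 : ℝ) 1 by simpa using hs)
    (Metric.mem_ball_self one_pos)
  have h0 : ∀ c : ℕ → ℝ, ∑' n, c n * (0 : ℝ) ^ n = c 0 := fun c => by
    rw [tsum_eq_single 0]
    · simp
    · intro n hn
      simp [hn]
  simp only [h0, hu0] at hconst
  rw [Real.exp_neg, hbs s hs] at hconst
  rw [show b 0 = 0 from rfl, neg_zero, Real.exp_zero, mul_one] at hconst
  exact (mul_inv_eq_one₀ (Real.exp_pos _).ne').1 hconst

end powerSeries

/-! ### The summable case, by Abel's theorem -/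

/-- The limit of a monotone sequence satisfying Sparre Andersen's recursion in the summable case. -/
theorem tendsto_exp_neg_tsum {u a : ℕ → ℝ} {C D : ℝ} (hu0 : u 0 = 1) (hu : ∀ n, |u n| ≤ C)
    (hmono : Antitone u) (ha : ∀ n, |a n| ≤ D)
    (hrec : ∀ n : ℕ, (n + 1 : ℝ) * u (n + 1) = ∑ j ∈ Finset.range (n + 1), a j * u (n - j))
    (hsum : Summable fun k : ℕ => 1 / ((k : ℝ) + 1) * (1 - a k)) :
    Tendsto u atTop (𝓝 (Real.exp (-∑' k : ℕ, 1 / ((k : ℝ) + 1) * (1 - a k)))) := by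
  obtain ⟨l, hl⟩ : ∃ l, Tendsto u atTop (𝓝 l) :=
    ⟨_, tendsto_atTop_ciInf hmono ⟨-C, by
      rintro _ ⟨n, rfl⟩
      exact (abs_le.1 (hu n)).1⟩⟩
  -- The partial sums of `d` are the values of `u`, and its power series is (1 - s)U(s). Abel's
  -- theorem therefore gives the limit of `u` as s ↑ 1.
  let d : ℕ → ℝ := fun n => Nat.casesOn n (u 0) fun k => u (k + 1) - u k
  have hd : ∀ n, ∑ i ∈ Finset.range (n + 1), d i = u n := by
    intro n
    rw [Finset.sum_range_succ', Finset.sum_range_sub]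
    simp [d]
  have h1 := Real.tendsto_tsum_powerSeries_nhdsWithin_lt
    ((tendsto_add_atTop_iff_nat 1).1 (hl.congr fun n => (hd n).symm))
  let e : ℕ → ℝ := fun n => Nat.casesOn n 0 fun k => 1 / ((k : ℝ) + 1) * (1 - a k)
  have he : ∀ n, ∑ i ∈ Finset.range (n + 1), e i =
      ∑ k ∈ Finset.range n, 1 / ((k : ℝ) + 1) * (1 - a k) := by
    intro n
    rw [Finset.sum_range_succ']
    simp [e]
  have h2 := Real.tendsto_tsum_powerSeries_nhdsWithin_lt
    ((tendsto_add_atTop_iff_nat 1).1 (hsum.hasSum.tendsto_sum_nat.congr fun n => (he n).symm))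
  have h3 : ∀ᶠ s : ℝ in 𝓝[<] 1, Real.exp (-∑' n, e n * s ^ n) = ∑' n, d n * s ^ n := by
    filter_upwards [Ioo_mem_nhdsLT (show (0 : ℝ) < 1 by norm_num)] with s hs
    have hs' : |s| < 1 := by rw [abs_of_pos hs.1]; exact hs.2
    have hus := summable_mul_pow_of_bounded hu hs'
    have hdb : ∀ n, |d n| ≤ C + C := by
      rintro (_ | n)
      · exact (hu 0).trans (by linarith [(abs_nonneg _).trans (hu 0)])
      · exact (abs_sub _ _).trans (add_le_add (hu _) (hu _))
    have h4 : ∑' n, d n * s ^ n = (1 - s) * ∑' n, u n * s ^ n := by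
      rw [(summable_mul_pow_of_bounded hdb hs').tsum_eq_zero_add, sub_mul, one_mul,
        hus.tsum_eq_zero_add]
      have : ∀ n, d (n + 1) * s ^ (n + 1) = u (n + 1) * s ^ (n + 1) - s * (u n * s ^ n) := by
        intro n
        simp only [d]
        ring
      simp only [this]
      rw [((summable_nat_add_iff 1).2 hus).tsum_sub (hus.mul_left s), tsum_mul_left,
        hus.tsum_eq_zero_add, show d 0 = u 0 from rfl]
      ring
    have h5 := Real.hasSum_pow_div_log_of_abs_lt_one hs'
    have ha' : Summable fun k : ℕ => a k / (k + 1) * s ^ (k + 1) := by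
      have hb : ∀ k : ℕ, |a k / (k + 1) * s| ≤ D := by
        intro k
        rw [abs_mul, abs_div, abs_of_nonneg (by positivity : (0 : ℝ) ≤ k + 1)]
        have := (div_le_self (abs_nonneg (a k))
          (by linarith [(k.cast_nonneg : (0 : ℝ) ≤ k)] : (1 : ℝ) ≤ k + 1)).trans (ha k)
        have h6 := mul_le_mul this hs'.le (abs_nonneg s) ((abs_nonneg _).trans (ha 0))
        simpa using h6
      refine (summable_mul_pow_of_bounded hb hs').congr fun k => by ring
    have heb : Summable fun n => e n * s ^ n := by
      rw [← summable_nat_add_iff 1]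
      refine (h5.summable.sub ha').congr fun k => ?_
      simp only [e]
      ring
    rw [h4, tsum_mul_pow_eq_exp hu0 hu ha hrec hs', heb.tsum_eq_zero_add]
    -- The constant 1 in 1 - a_k contributes the series of -log(1 - s), whose exponential cancels
    -- the factor 1 - s.
    have h6 : ∑' n : ℕ, e (n + 1) * s ^ (n + 1) =
        -Real.log (1 - s) - ∑' k : ℕ, a k / (k + 1) * s ^ (k + 1) := by
      rw [← h5.tsum_eq, ← h5.summable.tsum_sub ha']
      refine tsum_congr fun k => ?_
      simp only [e]
      ring
    rw [h6, show e 0 = 0 from rfl, zero_mul, zero_add, neg_sub, sub_neg_eq_add]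
    have h7 : 0 < 1 - s := by linarith [hs.2]
    rw [Real.exp_add, Real.exp_log h7, mul_comm]
  have h4 : Tendsto (fun s : ℝ => ∑' n, d n * s ^ n) (𝓝[<] 1)
      (𝓝 (Real.exp (-∑' k : ℕ, 1 / ((k : ℝ) + 1) * (1 - a k)))) :=
    ((Real.continuous_exp.tendsto _).comp h2.neg).congr' h3
  rw [← tendsto_nhds_unique h1 h4]
  exact hl

/-! ### Regular variation of the partial sums -/

lemma integral_floor_Ioi (c : ℕ → ℝ) (hc : Summable c) :
    ∫ t in Ioi (0 : ℝ), c ⌊t⌋₊ = ∑' n, c n := by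
  have hmap : (volume.restrict (Ioi (0 : ℝ))).map Nat.floor = Measure.count := by
    refine Measure.ext_of_singleton fun n => ?_
    rw [Measure.map_apply Nat.measurable_floor (measurableSet_singleton n),
      Measure.count_singleton, ← Measure.restrict_congr_set Ioi_ae_eq_Ici.symm,
      Measure.restrict_apply (Nat.measurable_floor (measurableSet_singleton n))]
    have : Nat.floor ⁻¹' {n} ∩ Ici (0 : ℝ) = Ico (n : ℝ) (n + 1) := by
      ext t
      simp only [mem_inter_iff, mem_preimage, mem_singleton_iff, mem_Ici, mem_Ico]
      constructor
      · rintro ⟨h, h0⟩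
        exact (Nat.floor_eq_iff h0).1 h
      · intro h
        have h0 : 0 ≤ t := (Nat.cast_nonneg n).trans h.1
        exact ⟨(Nat.floor_eq_iff h0).2 h, h0⟩
    rw [this]
    simp
  rw [← integral_map (f := c) Nat.measurable_floor.aemeasurable (by fun_prop), hmap,
    integral_countable]
  · simp
  · exact integrable_count_iff.2 hc.norm

section tauberian

variable {u a : ℕ → ℝ} {ρ : ℝ}

lemma psum_pos (hu0 : u 0 = 1) (hu : ∀ n, 0 ≤ u n) (n : ℕ) : 1 ≤ psum u (n + 1) := by
  rw [psum, Finset.sum_range_succ', hu0]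
  linarith [Finset.sum_nonneg fun i (_ : i ∈ Finset.range n) => hu (i + 1)]

/-- The term j = n of the recursion alone gives u_{n+1} ≥ a_n/(n + 1), eventually at least a
multiple of the harmonic series. -/
lemma tendsto_psum_atTop (hu0 : u 0 = 1) (hu : ∀ n, 0 ≤ u n) (ha0 : ∀ n, 0 ≤ a n)
    (hrec : ∀ n : ℕ, (n + 1 : ℝ) * u (n + 1) = ∑ j ∈ Finset.range (n + 1), a j * u (n - j))
    (hρ : 0 < ρ) (ha : Tendsto a atTop (𝓝 ρ)) : Tendsto (psum u) atTop atTop := by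
  refine (not_summable_iff_tendsto_nat_atTop_of_nonneg hu).1 fun hs => ?_
  obtain ⟨K, hK⟩ := eventually_atTop.1 (ha.eventually (lt_mem_nhds (half_lt_self hρ)))
  have h1 : ∀ n, K ≤ n → ρ / 2 * (1 / ((n : ℝ) + 1)) ≤ u (n + 1) := by
    intro n hn
    have h2 : a n * u (n - n) ≤ (n + 1 : ℝ) * u (n + 1) := by
      rw [hrec]
      exact Finset.single_le_sum (f := fun j => a j * u (n - j))
        (fun j _ => mul_nonneg (ha0 j) (hu _)) (Finset.self_mem_range_succ n)
    rw [Nat.sub_self, hu0, mul_one] at h2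
    have := (hK n hn).le.trans h2
    rw [mul_one_div, div_le_iff₀ (by positivity)]
    linarith
  have h2 : Summable fun n : ℕ => ρ / 2 * (1 / (((n + K : ℕ) : ℝ) + 1)) :=
    Summable.of_nonneg_of_le (fun n => by positivity) (fun n => h1 (n + K) (by omega))
      ((summable_nat_add_iff K).2 ((summable_nat_add_iff 1).2 hs))
  rw [summable_mul_left_iff (by positivity)] at h2
  have h3 := (summable_nat_add_iff (f := fun n : ℕ => 1 / (n : ℝ)) (K + 1)).1
    (h2.congr fun n => by push_cast; ring)
  exact Real.not_summable_one_div_natCast h3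

/-- The error is the sum of (a_j - ρ)u_{n-j} divided by the partial sum. Terms with j < K are
bounded in total by (1 + ρ)K, negligible because the partial sums diverge; the others have |a_j - ρ|
small. -/
lemma tendsto_mul_div_psum (hu0 : u 0 = 1) (hu : ∀ n, 0 ≤ u n) (hu1 : ∀ n, u n ≤ 1)
    (ha0 : ∀ n, 0 ≤ a n) (ha1 : ∀ n, a n ≤ 1)
    (hrec : ∀ n : ℕ, (n + 1 : ℝ) * u (n + 1) = ∑ j ∈ Finset.range (n + 1), a j * u (n - j))
    (hρ : 0 < ρ) (ha : Tendsto a atTop (𝓝 ρ)) :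
    Tendsto (fun n : ℕ => n * (u n / psum u n)) atTop (𝓝 ρ) := by
  rw [← tendsto_add_atTop_iff_nat 1]
  have hP := (tendsto_add_atTop_iff_nat 1).2 (tendsto_psum_atTop hu0 hu ha0 hrec hρ ha)
  rw [Metric.tendsto_atTop]
  intro ε hε
  obtain ⟨K, hK⟩ := Metric.tendsto_atTop.1 ha (ε / 2) (by positivity)
  obtain ⟨N, hN⟩ := eventually_atTop.1 (hP.eventually_gt_atTop ((1 + ρ) * K / (ε / 2)))
  refine ⟨N, fun n hn => ?_⟩
  have hPpos : 0 < psum u (n + 1) := one_pos.trans_le (psum_pos hu0 hu n)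
  have hPsum : psum u (n + 1) = ∑ j ∈ Finset.range (n + 1), u (n - j) := by
    rw [psum, ← Finset.sum_range_reflect]
    rfl
  have h1 : ((n + 1 : ℕ) : ℝ) * (u (n + 1) / psum u (n + 1)) - ρ =
      (∑ j ∈ Finset.range (n + 1), (a j - ρ) * u (n - j)) / psum u (n + 1) := by
    simp only [sub_mul, Finset.sum_sub_distrib]
    rw [← hrec, ← Finset.mul_sum, ← hPsum]
    push_cast
    field_simp
  have h2 : |∑ j ∈ Finset.range (n + 1), (a j - ρ) * u (n - j)| ≤
      (1 + ρ) * K + ε / 2 * psum u (n + 1) := by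
    refine (Finset.abs_sum_le_sum_abs _ _).trans ?_
    have h3 : ∀ j ∈ Finset.range (n + 1), |(a j - ρ) * u (n - j)| ≤
        (if j < K then 1 + ρ else 0) + ε / 2 * u (n - j) := by
      intro j _
      rw [abs_mul, abs_of_nonneg (hu (n - j))]
      split_ifs with hj
      · have h4 : |a j - ρ| ≤ 1 + ρ := by
          rw [abs_le]
          constructor <;> linarith [ha0 j, ha1 j]
        have h5 := mul_le_mul h4 (hu1 (n - j)) (hu _) (by linarith)
        have := hu (n - j)
        nlinarith
      · have h4 := (hK j (by omega)).le
        rw [Real.dist_eq] at h4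
        rw [zero_add]
        exact mul_le_mul_of_nonneg_right h4 (hu _)
    refine (Finset.sum_le_sum h3).trans ?_
    rw [Finset.sum_add_distrib, ← Finset.mul_sum, ← hPsum]
    gcongr
    rw [← Finset.sum_filter, Finset.sum_const, nsmul_eq_mul, mul_comm]
    have : ((Finset.range (n + 1)).filter (· < K)).card ≤ K := by
      calc _ ≤ (Finset.range K).card := Finset.card_le_card fun i hi => by
            simp only [Finset.mem_filter, Finset.mem_range] at hi ⊢
            exact hi.2
        _ = K := Finset.card_range K
    gcongr
  rw [Real.dist_eq, h1, abs_div, abs_of_pos hPpos, div_lt_iff₀ hPpos]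
  have h3 := hN n hn
  rw [div_lt_iff₀ (by positivity)] at h3
  linarith

/-- If `n * (r (n + 1) - r n) → 0`, then `r` is asymptotically constant along comparable indices. -/
lemma tendsto_sub_of_mul_diff {r : ℕ → ℝ}
    (hr : Tendsto (fun n : ℕ => n * (r (n + 1) - r n)) atTop (𝓝 0)) {m : ℕ → ℕ} {x : ℝ}
    (hx : 0 < x) (hm : Tendsto (fun n : ℕ => (m n : ℝ) / n) atTop (𝓝 x)) :
    Tendsto (fun n => r (m n) - r n) atTop (𝓝 0) := by
  have hbound : ∀ {δ : ℝ} {N : ℕ}, 0 < N → (∀ n, N ≤ n → |(n : ℝ) * (r (n + 1) - r n)| ≤ δ) →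
      ∀ k l, N ≤ k → k ≤ l → |r l - r k| ≤ δ * (((l : ℝ) - k) / k) := by
    intro δ N hN0 hN k l hk hkl
    have hk0 : (0 : ℝ) < k := by exact_mod_cast hN0.trans_le hk
    have hδ : 0 ≤ δ := (abs_nonneg _).trans (hN N le_rfl)
    induction l, hkl using Nat.le_induction with
    | base => simp
    | succ l hkl ih =>
      have h1 := hN l (hk.trans hkl)
      have hkl' : (k : ℝ) ≤ l := by exact_mod_cast hkl
      rw [abs_mul, Nat.abs_cast] at h1
      have h2 : |r (l + 1) - r l| ≤ δ * (1 / k) := by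
        rw [mul_one_div, le_div_iff₀ hk0]
        nlinarith [abs_nonneg (r (l + 1) - r l)]
      calc |r (l + 1) - r k| ≤ |r (l + 1) - r l| + |r l - r k| := abs_sub_le _ _ _
        _ ≤ δ * (1 / k) + δ * (((l : ℝ) - k) / k) := add_le_add h2 ih
        _ = _ := by push_cast; ring
  have hmtop : Tendsto m atTop atTop := by
    have := hm.pos_mul_atTop hx (tendsto_natCast_atTop_atTop (R := ℝ))
    refine tendsto_natCast_atTop_iff (R := ℝ) |>.1 (this.congr' ?_)
    filter_upwards [eventually_gt_atTop 0] with n hn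
    have : (n : ℝ) ≠ 0 := by positivity
    field_simp
  have hinv : Tendsto (fun n : ℕ => (n : ℝ) / m n) atTop (𝓝 x⁻¹) :=
    (hm.inv₀ hx.ne').congr fun n => by rw [inv_div]
  rw [Metric.tendsto_atTop]
  intro ε hε
  -- Eventually m/n < x + 1 and n/m < x⁻¹ + 1, so `M` serves whichever of the two indices is larger.
  let M : ℝ := x + 1 + (x⁻¹ + 1)
  have hM : 0 < M := by positivity
  obtain ⟨N, hN⟩ := Metric.tendsto_atTop.1 hr (ε / 2 / M) (by positivity)
  have hN' : ∀ n, N + 1 ≤ n → |(n : ℝ) * (r (n + 1) - r n)| ≤ ε / 2 / M := by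
    intro n hn
    have := (hN n (by omega)).le
    rwa [Real.dist_eq, sub_zero] at this
  refine eventually_atTop.1 ?_
  filter_upwards [eventually_ge_atTop (N + 1), hmtop.eventually_ge_atTop (N + 1),
    hm.eventually (gt_mem_nhds (lt_add_one x)),
    hinv.eventually (gt_mem_nhds (lt_add_one x⁻¹))] with n hn hmn h1 h2
  have hn0 : (0 : ℝ) < n := by exact_mod_cast (by omega : 0 < n)
  have hm0 : (0 : ℝ) < m n := by exact_mod_cast (by omega : 0 < m n)
  have hx' : 0 < x⁻¹ := by positivity
  rw [Real.dist_eq, sub_zero]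
  have key : |r (m n) - r n| ≤ ε / 2 / M * M := by
    rcases le_total n (m n) with h | h
    · refine (hbound (by omega) hN' n (m n) hn h).trans ?_
      gcongr
      rw [sub_div, div_self hn0.ne']
      simp only [M]
      linarith
    · rw [abs_sub_comm]
      refine (hbound (by omega) hN' (m n) n hmn h).trans ?_
      gcongr
      rw [sub_div, div_self hm0.ne']
      simp only [M]
      linarith
  rw [div_mul_cancel₀ _ hM.ne'] at key
  linarith

/-- The partial sums are regularly varying with index `ρ`. -/
lemma tendsto_psum_div_psum (hu0 : u 0 = 1) (hu : ∀ n, 0 ≤ u n)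
    (hθ : Tendsto (fun n : ℕ => n * (u n / psum u n)) atTop (𝓝 ρ)) {m : ℕ → ℕ} {x : ℝ}
    (hx : 0 < x) (hm : Tendsto (fun n : ℕ => (m n : ℝ) / n) atTop (𝓝 x)) (hm0 : ∀ n, 0 < m n) :
    Tendsto (fun n => psum u (m n) / psum u n) atTop (𝓝 (x ^ ρ)) := by
  have hP : ∀ n, 0 < n → 0 < psum u n := fun n hn => by
    obtain ⟨k, rfl⟩ : ∃ k, n = k + 1 := ⟨n - 1, by omega⟩
    exact one_pos.trans_le (psum_pos hu0 hu k)
  -- The increment of `r` is log(1 + u_n / psum u n) - ρ log(1 + 1/n); times n, both parts tend to ρ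
  -- and cancel.
  let r : ℕ → ℝ := fun n => Real.log (psum u n) - ρ * Real.log n
  have hr : Tendsto (fun n : ℕ => n * (r (n + 1) - r n)) atTop (𝓝 0) := by
    have h1 := Real.tendsto_nat_mul_log_one_add_of_tendsto hθ
    have h2 := Real.tendsto_nat_mul_log_one_add_of_tendsto (g := fun n => 1 / (n : ℝ)) (t := 1)
      (tendsto_const_nhds.congr' (by
        filter_upwards [eventually_gt_atTop 0] with n hn
        have : (n : ℝ) ≠ 0 := by positivity
        field_simp))
    have h3 := h1.sub (h2.const_mul ρ)
    rw [mul_one, sub_self] at h3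
    refine h3.congr' ?_
    filter_upwards [eventually_gt_atTop 0] with n hn
    have hn0 : (0 : ℝ) < n := by exact_mod_cast hn
    have hPn := hP n hn
    have h4 : 1 + u n / psum u n = psum u (n + 1) / psum u n := by
      rw [psum_succ]
      field_simp
    have h5 : 1 + 1 / (n : ℝ) = ((n + 1 : ℕ) : ℝ) / n := by
      push_cast
      field_simp
    rw [h4, h5, Real.log_div (hP _ (by omega)).ne' hPn.ne',
      Real.log_div (by positivity) (by positivity)]
    simp only [r]
    ring
  have h1 := (Real.continuous_exp.tendsto _).comp (tendsto_sub_of_mul_diff hr hx hm)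
  rw [Real.exp_zero] at h1
  have h2 := h1.mul (hm.rpow_const (p := ρ) (Or.inl hx.ne'))
  rw [one_mul] at h2
  refine h2.congr' ?_
  filter_upwards [eventually_gt_atTop 0] with n hn
  have hn0 : (0 : ℝ) < n := by exact_mod_cast hn
  have hmn0 : (0 : ℝ) < m n := by exact_mod_cast hm0 n
  have h3 : r (m n) - r n = Real.log (psum u (m n)) - Real.log (psum u n) -
      ρ * Real.log ((m n : ℝ) / n) := by
    rw [Real.log_div hmn0.ne' hn0.ne']
    simp only [r]
    ring
  simp only [Function.comp_apply]
  rw [h3, Real.exp_sub, Real.exp_sub, Real.exp_log (hP _ (hm0 n)), Real.exp_log (hP n hn),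
    Real.rpow_def_of_pos (by positivity), mul_comm ρ]
  exact div_mul_cancel₀ _ (Real.exp_pos _).ne'

end tauberian

/-! ### The Abelian theorem and the asymptotics -/

section tauberian

variable {u a : ℕ → ℝ} {C ρ : ℝ}

lemma hasSum_psum_mul_pow (hu : ∀ n, |u n| ≤ C) {s : ℝ} (hs : |s| < 1) :
    HasSum (fun n => psum u (n + 1) * s ^ n) ((∑' n, u n * s ^ n) * (1 - s)⁻¹) := by
  have h1 := (summable_mul_pow_of_bounded hu hs).norm
  have h2 : Summable fun n : ℕ => ‖s ^ n‖ := (summable_geometric_of_abs_lt_one hs).norm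
  have h3 : ∀ n, ∑ k ∈ Finset.range (n + 1), u k * s ^ k * s ^ (n - k) =
      psum u (n + 1) * s ^ n := by
    intro n
    rw [psum, Finset.sum_mul]
    refine Finset.sum_congr rfl fun k hk => ?_
    have := Finset.mem_range.1 hk
    rw [mul_assoc, ← pow_add, show k + (n - k) = n by omega]
  have h4 := summable_norm_sum_mul_range_of_summable_norm h1 h2
  have h5 := tsum_mul_tsum_eq_tsum_sum_range_of_summable_norm h1 h2
  simp only [h3] at h4 h5
  rw [tsum_geometric_of_abs_lt_one hs] at h5
  rw [h5]
  exact h4.of_norm.hasSum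

/-- By monotonicity each term beyond n is at most u_n, hence at most the average of the first n
terms. This supplies the domination in the Abelian theorem. -/
lemma psum_le_mul_psum (hu : ∀ n, 0 ≤ u n) (hmono : Antitone u) {n : ℕ} (hn : 0 < n) (m : ℕ) :
    psum u m ≤ (1 + (m : ℝ) / n) * psum u n := by
  have hn0 : (0 : ℝ) < n := by exact_mod_cast hn
  have hP : 0 ≤ psum u n := Finset.sum_nonneg fun i _ => hu i
  rcases le_total m n with h | h
  · have h1 : psum u m ≤ psum u n :=
      Finset.sum_le_sum_of_subset_of_nonneg (Finset.range_mono h) fun i _ _ => hu i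
    refine h1.trans (le_mul_of_one_le_left hP ?_)
    have : (0 : ℝ) ≤ (m : ℝ) / n := by positivity
    linarith
  · obtain ⟨k, rfl⟩ := Nat.exists_eq_add_of_le h
    have h1 : psum u (n + k) ≤ psum u n + k * u n := by
      rw [psum, Finset.sum_range_add]
      refine add_le_add le_rfl ?_
      refine (Finset.sum_le_card_nsmul _ _ (u n) fun i _ => hmono (by omega)).trans ?_
      simp
    have h2 : n * u n ≤ psum u n := by
      have := Finset.card_nsmul_le_sum (Finset.range n) u (u n)
        fun i hi => hmono (Finset.mem_range.1 hi).le
      simpa [psum] using this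
    have h3 : k * u n ≤ ((n + k : ℕ) : ℝ) / n * psum u n := by
      calc (k : ℝ) * u n = k / n * (n * u n) := by field_simp
        _ ≤ k / n * psum u n := by gcongr
        _ ≤ ((n + k : ℕ) : ℝ) / n * psum u n := by
          gcongr
          omega
    linarith

/-- The series with coefficients `psum u (j + 1)` is U(s)/(1 - s). Written as an integral of a step
function and rescaled by t = nx, it acquires a factor 1/n, which is 1 - s at s = 1 - 1/n. -/
lemma tsum_mul_pow_eq_integral (hu : ∀ n, |u n| ≤ C) {n : ℕ} (hn : 2 ≤ n) :
    ∫ x in Ioi (0 : ℝ), psum u (⌊n * x⌋₊ + 1) / psum u n * (1 - 1 / (n : ℝ)) ^ ⌊n * x⌋₊ =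
      (∑' j, u j * (1 - 1 / (n : ℝ)) ^ j) / psum u n := by
  have hn2 : (2 : ℝ) ≤ n := by exact_mod_cast hn
  have hn0 : (0 : ℝ) < n := by linarith
  have h1n : 1 / (n : ℝ) ≤ 1 / 2 := by gcongr
  have h1n' : 0 < 1 / (n : ℝ) := by positivity
  have hs : |1 - 1 / (n : ℝ)| < 1 := by
    rw [abs_of_nonneg (by linarith)]
    linarith
  have h1 := hasSum_psum_mul_pow hu hs
  have h2 := h1.div_const (psum u n)
  have h3 := integral_comp_mul_left_Ioi
    (fun t => psum u (⌊t⌋₊ + 1) * (1 - 1 / (n : ℝ)) ^ ⌊t⌋₊ / psum u n) 0 hn0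
  rw [mul_zero, integral_floor_Ioi _ h2.summable, h2.tsum_eq] at h3
  calc _ = _ := integral_congr_ae (.of_forall fun x => by ring)
    _ = _ := h3
    _ = _ := by
      rw [smul_eq_mul, sub_sub_cancel, one_div, inv_inv]
      field_simp

/-- An Abelian theorem: the generating function at `1 - 1 / n` is comparable to the partial sums. -/
theorem tendsto_tsum_div_psum (hu0 : u 0 = 1) (hu : ∀ n, 0 ≤ u n) (hmono : Antitone u)
    (hρ : 0 < ρ) (hθ : Tendsto (fun n : ℕ => n * (u n / psum u n)) atTop (𝓝 ρ)) :
    Tendsto (fun n : ℕ => (∑' j, u j * (1 - 1 / (n : ℝ)) ^ j) / psum u n) atTop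
      (𝓝 (Real.Gamma (ρ + 1))) := by
  have hub : ∀ n, |u n| ≤ 1 := fun n => by
    rw [abs_of_nonneg (hu n), ← hu0]
    exact hmono (Nat.zero_le n)
  have hP : ∀ n, 0 < n → 0 < psum u n := fun n hn => by
    obtain ⟨k, rfl⟩ : ∃ k, n = k + 1 := ⟨n - 1, by omega⟩
    exact one_pos.trans_le (psum_pos hu0 hu k)
  rw [Real.Gamma_eq_integral (by linarith), add_sub_cancel_right]
  have key : Tendsto (fun n : ℕ => ∫ x in Ioi (0 : ℝ),
      psum u (⌊n * x⌋₊ + 1) / psum u n * (1 - 1 / (n : ℝ)) ^ ⌊n * x⌋₊) atTop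
      (𝓝 (∫ x in Ioi (0 : ℝ), Real.exp (-x) * x ^ ρ)) := by
    refine tendsto_integral_filter_of_dominated_convergence
      -- The ratio of partial sums is at most 1 + (⌊nx⌋ + 1)/n ≤ 2 + x, and the power is at most
      -- exp(-⌊nx⌋/n) ≤ exp(1 - x).
      (fun x => (2 + x) * Real.exp (1 - x)) ?_ ?_ ?_ ?_
    · refine .of_forall fun n => Measurable.aestronglyMeasurable ?_
      exact (measurable_from_nat (f := fun j => psum u (j + 1) / psum u n *
        (1 - 1 / (n : ℝ)) ^ j)).comp (Nat.measurable_floor.comp (measurable_id.const_mul _))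
    · filter_upwards [eventually_ge_atTop 2] with n hn
      have hn2 : (2 : ℝ) ≤ n := by exact_mod_cast hn
      have hn0 : (0 : ℝ) < n := by linarith
      have h1n : 1 / (n : ℝ) ≤ 1 / 2 := by gcongr
      have h1n' : 0 < 1 / (n : ℝ) := by positivity
      filter_upwards [ae_restrict_mem measurableSet_Ioi] with x hx
      have hx : 0 < x := hx
      have hfl : (⌊n * x⌋₊ : ℝ) ≤ n * x := Nat.floor_le (by positivity)
      have hfl' : n * x < ⌊n * x⌋₊ + 1 := Nat.lt_floor_add_one _
      have hs0 : 0 ≤ 1 - 1 / (n : ℝ) := by linarith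
      rw [Real.norm_of_nonneg (mul_nonneg (div_nonneg (hP _ (by omega)).le (hP n (by omega)).le)
        (pow_nonneg hs0 _))]
      refine mul_le_mul ?_ ?_ (pow_nonneg hs0 _) (by positivity)
      · rw [div_le_iff₀ (hP n (by omega))]
        refine (psum_le_mul_psum hu hmono (n := n) (by omega) _).trans ?_
        refine mul_le_mul_of_nonneg_right ?_ (hP n (by omega)).le
        have : ((⌊n * x⌋₊ + 1 : ℕ) : ℝ) / n ≤ x + 1 := by
          rw [div_le_iff₀ hn0]
          push_cast
          nlinarith
        linarith
      · calc (1 - 1 / (n : ℝ)) ^ ⌊n * x⌋₊ ≤ Real.exp (-(1 / (n : ℝ))) ^ ⌊n * x⌋₊ :=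
            pow_le_pow_left₀ hs0 (Real.one_sub_le_exp_neg _) _
          _ = Real.exp (-(⌊n * x⌋₊ / n)) := by
            rw [← Real.exp_nat_mul]
            congr 1
            ring
          _ ≤ Real.exp (1 - x) := by
            rw [Real.exp_le_exp]
            have : x - 1 ≤ (⌊n * x⌋₊ : ℝ) / n := by
              rw [le_div_iff₀ hn0]
              nlinarith
            linarith
    · have h1 := Real.GammaIntegral_convergent (s := 1) (by norm_num)
      have h2 := Real.GammaIntegral_convergent (s := 2) (by norm_num)
      refine (((h1.const_mul 2).add h2).const_mul (Real.exp 1)).congr ?_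
      filter_upwards [ae_restrict_mem measurableSet_Ioi] with x hx
      simp only [Pi.add_apply]
      rw [sub_self, Real.rpow_zero, show (2 : ℝ) - 1 = 1 by norm_num, Real.rpow_one, sub_eq_add_neg,
        Real.exp_add]
      ring
    · filter_upwards [ae_restrict_mem measurableSet_Ioi] with x hx
      have hx : 0 < x := hx
      have hfl : Tendsto (fun n : ℕ => (⌊n * x⌋₊ : ℝ) / n) atTop (𝓝 x) :=
        ((tendsto_nat_floor_mul_div_atTop hx.le).comp tendsto_natCast_atTop_atTop).congr
          fun n => by simp [mul_comm]
      have hm : Tendsto (fun n : ℕ => ((⌊n * x⌋₊ + 1 : ℕ) : ℝ) / n) atTop (𝓝 x) := by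
        have := hfl.add (tendsto_one_div_atTop_nhds_zero_nat (𝕜 := ℝ))
        rw [add_zero] at this
        refine this.congr fun n => ?_
        push_cast
        ring
      have h1 := tendsto_psum_div_psum hu0 hu hθ hx hm fun n => by omega
      have h2 := Real.tendsto_nat_mul_log_one_add_of_tendsto (g := fun n => -(1 / (n : ℝ)))
        (t := -1) (tendsto_const_nhds.congr' (by
          filter_upwards [eventually_gt_atTop 0] with n hn
          have : (n : ℝ) ≠ 0 := by positivity
          field_simp))
      have h3 := (Real.continuous_exp.tendsto _).comp (hfl.mul h2)
      rw [mul_neg_one] at h3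
      rw [mul_comm (Real.exp (-x))]
      refine h1.mul (h3.congr' ?_)
      filter_upwards [eventually_ge_atTop 2] with n hn
      have hn2 : (2 : ℝ) ≤ n := by exact_mod_cast hn
      have h1n : 1 / (n : ℝ) ≤ 1 / 2 := by gcongr
      have hs0 : 0 < 1 - 1 / (n : ℝ) := by linarith
      simp only [Function.comp_apply]
      rw [← sub_eq_add_neg, ← mul_assoc, div_mul_cancel₀ _ (by linarith), Real.exp_nat_mul,
        Real.exp_log hs0]
  refine key.congr' ?_
  filter_upwards [eventually_ge_atTop 2] with n hn
  exact tsum_mul_pow_eq_integral hub hn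

/-- The regularly varying asymptotics of a sequence satisfying Sparre Andersen's recursion. -/
theorem isEquivalent_of_recursion (hu0 : u 0 = 1) (hu : ∀ n, 0 ≤ u n) (hmono : Antitone u)
    (ha0 : ∀ n, 0 ≤ a n) (ha1 : ∀ n, a n ≤ 1)
    (hrec : ∀ n : ℕ, (n + 1 : ℝ) * u (n + 1) = ∑ j ∈ Finset.range (n + 1), a j * u (n - j))
    (hρ : 0 < ρ) (ha : Tendsto a atTop (𝓝 ρ)) :
    Asymptotics.IsEquivalent atTop u fun n : ℕ => 1 / Real.Gamma ρ * (n : ℝ) ^ (ρ - 1) *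
      Real.exp (∑' k : ℕ, (1 - 1 / (n : ℝ)) ^ (k + 1) / ((k : ℝ) + 1) * (a k - ρ)) := by
  have hu1 : ∀ n, u n ≤ 1 := fun n => hu0 ▸ hmono (Nat.zero_le n)
  have hub : ∀ n, |u n| ≤ 1 := fun n => by rw [abs_of_nonneg (hu n)]; exact hu1 n
  have hab : ∀ n, |a n| ≤ 1 := fun n => by rw [abs_of_nonneg (ha0 n)]; exact ha1 n
  have hθ := tendsto_mul_div_psum hu0 hu hu1 ha0 ha1 hrec hρ ha
  have hG := tendsto_tsum_div_psum hu0 hu hmono hρ hθ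
  have hΓ := Real.Gamma_pos_of_pos hρ
  have hΓ1 := Real.Gamma_pos_of_pos (by linarith : 0 < ρ + 1)
  have hv : ∀ᶠ n : ℕ in atTop, 1 / Real.Gamma ρ * (n : ℝ) ^ (ρ - 1) *
      Real.exp (∑' k : ℕ, (1 - 1 / (n : ℝ)) ^ (k + 1) / ((k : ℝ) + 1) * (a k - ρ)) =
      1 / Real.Gamma ρ * ((∑' j, u j * (1 - 1 / (n : ℝ)) ^ j) / n) ∧
      0 < ∑' j, u j * (1 - 1 / (n : ℝ)) ^ j := by
    filter_upwards [eventually_ge_atTop 2] with n hn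
    have hn2 : (2 : ℝ) ≤ n := by exact_mod_cast hn
    have hn0 : (0 : ℝ) < n := by linarith
    have h1n : 1 / (n : ℝ) ≤ 1 / 2 := by gcongr
    have h1n' : 0 < 1 / (n : ℝ) := by positivity
    have hs : |1 - 1 / (n : ℝ)| < 1 := by
      rw [abs_of_nonneg (by linarith)]
      linarith
    have h1 := Real.hasSum_pow_div_log_of_abs_lt_one hs
    have ha' : Summable fun k : ℕ => a k / (k + 1) * (1 - 1 / (n : ℝ)) ^ (k + 1) := by
      refine Summable.of_nonneg_of_le (fun k => ?_) (fun k => ?_) h1.summable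
      · have := ha0 k
        have : 0 ≤ 1 - 1 / (n : ℝ) := by linarith
        positivity
      · rw [div_mul_eq_mul_div]
        have : 0 ≤ (1 - 1 / (n : ℝ)) ^ (k + 1) := pow_nonneg (by linarith) _
        gcongr
        exact mul_le_of_le_one_left this (ha1 k)
    -- The ρ-part is a logarithmic series summing to ρ log n; hence U(1 - 1/n) is n^ρ times the
    -- exponential in the claim.
    have h2 : ∑' k : ℕ, (1 - 1 / (n : ℝ)) ^ (k + 1) / ((k : ℝ) + 1) * (a k - ρ) =
        ∑' k : ℕ, a k / (k + 1) * (1 - 1 / (n : ℝ)) ^ (k + 1) - ρ * Real.log n := by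
      have h3 : -Real.log (1 - (1 - 1 / (n : ℝ))) = Real.log n := by
        rw [sub_sub_cancel, one_div, Real.log_inv, neg_neg]
      rw [← h3, ← h1.tsum_eq, ← tsum_mul_left, ← ha'.tsum_sub (h1.summable.mul_left ρ)]
      exact tsum_congr fun k => by ring
    rw [tsum_mul_pow_eq_exp hu0 hub hab hrec hs, h2, Real.exp_sub]
    refine ⟨?_, Real.exp_pos _⟩
    rw [mul_comm ρ, ← Real.rpow_def_of_pos hn0, Real.rpow_sub_one hn0.ne']
    have : (n : ℝ) ^ ρ ≠ 0 := (Real.rpow_pos_of_pos hn0 ρ).ne'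
    field_simp
  refine (Asymptotics.isEquivalent_iff_tendsto_one ?_).2 ?_
  · filter_upwards [hv, eventually_gt_atTop 0] with n h hn
    have hn0 : (0 : ℝ) < n := by exact_mod_cast hn
    rw [h.1]
    have := h.2
    positivity
  -- The partial sum cancels between the two limits, leaving Γ(ρ)ρ/Γ(ρ + 1) = 1.
  · have h1 := (hθ.mul (hG.inv₀ hΓ1.ne')).const_mul (Real.Gamma ρ)
    rw [Real.Gamma_add_one hρ.ne', show Real.Gamma ρ * (ρ * (ρ * Real.Gamma ρ)⁻¹) = 1 by
      field_simp] at h1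
    refine h1.congr' ?_
    filter_upwards [hv, eventually_gt_atTop 0] with n h hn
    have hn0 : (0 : ℝ) < n := by exact_mod_cast hn
    have hPn : 0 < psum u n := by
      obtain ⟨k, rfl⟩ : ∃ k, n = k + 1 := ⟨n - 1, by omega⟩
      exact one_pos.trans_le (psum_pos hu0 hu k)
    have hG0 := h.2
    rw [Pi.div_apply, h.1]
    field_simp

end tauberian

/-! ### The probability of returning to zero -/

section zero

variable (ν : Measure ℝ) [IsProbabilityMeasure ν]

/-- The sequences whose partial sums stay nonpositive and vanish at time `m`. -/
def returnBelow (m : ℕ) : Set (ℕ → ℝ) := {x | psum x m = 0 ∧ ∀ j ≤ m, psum x j ≤ 0}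

lemma measurableSet_returnBelow (m : ℕ) : MeasurableSet (returnBelow m) := by
  have : returnBelow m = {x | psum x m = 0} ∩ ⋂ j, ⋂ _ : j ≤ m, {x | psum x j ≤ 0} := by
    ext; simp [returnBelow]
  rw [this]
  exact (measurableSet_eq_fun (measurable_psum m) measurable_const).inter
    (.iInter fun j => .iInter fun _ => measurableSet_le (measurable_psum j) measurable_const)

lemma ladderAt_dep (H : Set ℝ) (k : ℕ) (x y : ℕ → ℝ) (h : ∀ i < k, x i = y i)
    (hx : x ∈ ladderAt H k) : y ∈ ladderAt H k := by
  intro j hj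
  rw [← psum_congr h, ← psum_congr fun i hi => h i (by omega)]
  exact hx j hj

/-- Cut the path at the first time k at which it takes its final, maximal value: k is a strict
ladder time, and from there the path stays below and returns. -/
lemma real_ladderAt_Ici_le (n : ℕ) :
    (iidLaw ν).real (ladderAt (Ici 0) n) ≤
      ∑ k ∈ Finset.range (n + 1), (iidLaw ν).real (ladderAt (Ioi 0) k) *
        (iidLaw ν).real (returnBelow (n - k)) := by
  have hsub : ladderAt (Ici 0) n ⊆ ⋃ k ∈ Finset.range (n + 1),
      ladderAt (Ioi 0) k ∩ {x | (fun i => x (i + k)) ∈ returnBelow (n - k)} := by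
    classical
    intro x hx
    have hex : ∃ k, psum x n = psum x k := ⟨n, rfl⟩
    have hk := Nat.find_spec hex
    have hkn : Nat.find hex ≤ n := Nat.find_min' hex rfl
    have hx' : ∀ j ≤ n, psum x j ≤ psum x n := fun j hj => by
      rcases hj.lt_or_eq with h | rfl
      · exact sub_nonneg.1 (hx j h)
      · exact le_rfl
    simp only [mem_iUnion, exists_prop, Finset.mem_range]
    refine ⟨Nat.find hex, by omega, fun j hj => ?_, ?_, fun j hj => ?_⟩
    · rw [← hk]
      exact sub_pos.2 (lt_of_le_of_ne (hx' j (by omega)) fun h => Nat.find_min hex hj h.symm)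
    · rw [psum_shift, show Nat.find hex + (n - Nat.find hex) = n by omega]
      exact sub_eq_zero.2 hk
    · rw [psum_shift, ← hk]
      exact sub_nonpos.2 (hx' _ (by omega))
  refine (measureReal_mono hsub (measure_ne_top _ _)).trans ((measureReal_biUnion_finset_le _ _).trans_eq ?_)
  refine Finset.sum_congr rfl fun k _ => ?_
  exact iidLaw_inter_shift ν (measurableSet_ladderAt measurableSet_Ioi k)
    (measurableSet_returnBelow _) (ladderAt_dep _ k)

/-- Appending one positive step to such a path gives a first entry into `Ioi 0` at time m + 1. As
first entries are disjoint, this makes `returnBelow` summable. -/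
lemma real_returnBelow_mul_le (m : ℕ) :
    (iidLaw ν).real (returnBelow m) * ν.real (Ioi 0) ≤
      (iidLaw ν).real (entryAt (Ioi 0) m) := by
  have h0 : MeasurableSet {x : ℕ → ℝ | x 0 ∈ Ioi 0} := measurable_pi_apply 0 measurableSet_Ioi
  have h1 : (iidLaw ν).real {x : ℕ → ℝ | x 0 ∈ Ioi 0} = ν.real (Ioi 0) := by
    have := Measure.infinitePi_map_eval (fun _ : ℕ => ν) 0
    conv_rhs => rw [← this]
    rw [map_measureReal_apply (measurable_pi_apply 0) measurableSet_Ioi]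
    rfl
  rw [← h1, ← iidLaw_inter_shift ν (measurableSet_returnBelow m) h0]
  · refine measureReal_mono ?_
    rintro x ⟨⟨hx0, hx⟩, hx1⟩
    refine ⟨fun j _ hj => not_lt.2 (hx j hj), ?_⟩
    simp only [mem_ofPred_eq, psum_succ, hx0, zero_add] at hx1 ⊢
    exact hx1
  · rintro x y h ⟨hx0, hx⟩
    refine ⟨?_, fun j hj => ?_⟩
    · rwa [← psum_congr h]
    · rw [← psum_congr fun i hi => h i (by omega)]
      exact hx j hj

lemma sum_real_entryAt_le {H : Set ℝ} (hH : MeasurableSet H) (n : ℕ) :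
    ∑ m ∈ Finset.range n, (iidLaw ν).real (entryAt H m) ≤ 1 := by
  rw [← measureReal_biUnion_finset]
  · exact measureReal_le_one
  · have hlt : ∀ a b, a < b → ∀ x, x ∈ entryAt H a → x ∈ entryAt H b → False :=
      fun a b hab x ha hb => hb.1 (a + 1) (by omega) hab ha.2
    intro a _ b _ hab
    rw [Function.onFun, Set.disjoint_left]
    intro x ha hb
    rcases lt_or_gt_of_ne hab with h | h
    · exact hlt a b h x ha hb
    · exact hlt b a h x hb ha
  · exact fun m _ => measurableSet_entryAt hH m

lemma summable_real_returnBelow (hν : 0 < ν.real (Ioi 0)) :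
    Summable fun m => (iidLaw ν).real (returnBelow m) := by
  refine summable_of_sum_range_le (c := 1 / ν.real (Ioi 0)) (fun _ => measureReal_nonneg) fun n => ?_
  rw [le_div_iff₀ hν, Finset.sum_mul]
  exact (Finset.sum_le_sum fun m _ => real_returnBelow_mul_le ν m).trans
    (sum_real_entryAt_le ν measurableSet_Ioi n)

lemma real_psum_mem_Ici (n : ℕ) : (iidLaw ν).real {x | psum x n ∈ Ici 0} =
    (iidLaw ν).real {x | psum x n ∈ Ioi 0} + (iidLaw ν).real {x | psum x n = 0} := by
  rw [← measureReal_union]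
  · congr 1
    ext x
    simp only [mem_ofPred_eq, mem_union, mem_Ici, mem_Ioi, le_iff_lt_or_eq, eq_comm]
  · rw [Set.disjoint_left]
    intro x h1 h2
    exact h1.ne' h2
  · exact measurableSet_eq_fun (measurable_psum n) measurable_const

/-- By the exponential formula the weak generating function over the strict one is the exponential
of the series of P(S_k = 0)s^k/k. The cut at a strict ladder time bounds this quotient, uniformly in
s < 1, by the total mass of `returnBelow`. -/
lemma summable_real_psum_eq_zero_of_pos (hν : 0 < ν.real (Ioi 0)) :
    Summable fun k : ℕ => 1 / ((k : ℝ) + 1) * (iidLaw ν).real {x | psum x (k + 1) = 0} := by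
  have hv := summable_real_returnBelow ν hν
  have h01 : ∀ A : Set (ℕ → ℝ), |(iidLaw ν).real A| ≤ 1 := fun A => by
    rw [abs_of_nonneg measureReal_nonneg]
    exact measureReal_le_one
  have hmain : ∀ s : ℝ, 0 < s → s < 1 →
      ∀ n, ∑ k ∈ Finset.range n, 1 / ((k : ℝ) + 1) *
        (iidLaw ν).real {x | psum x (k + 1) = 0} * s ^ (k + 1) ≤
        Real.log (∑' m, (iidLaw ν).real (returnBelow m)) := by
    intro s hs0 hs1 n
    have hs : |s| < 1 := by rwa [abs_of_pos hs0]
    have hb : ∀ H : Set ℝ, Summable fun k : ℕ =>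
        (iidLaw ν).real {x | psum x (k + 1) ∈ H} / (k + 1) * s ^ (k + 1) := by
      intro H
      refine Summable.of_nonneg_of_le (fun k => by positivity) (fun k => ?_)
        (Real.hasSum_pow_div_log_of_abs_lt_one hs).summable
      rw [div_mul_eq_mul_div]
      gcongr
      exact mul_le_of_le_one_left (by positivity) measureReal_le_one
    have h1 := tsum_mul_pow_eq_exp (u := fun n => (iidLaw ν).real (ladderAt (Ici 0) n))
      (real_ladderAt_zero ν _) (fun _ => h01 _) (fun _ => h01 _)
      (sparreAndersen ν isHalfLine_Ici) hs
    have h2 := tsum_mul_pow_eq_exp (u := fun n => (iidLaw ν).real (ladderAt (Ioi 0) n))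
      (real_ladderAt_zero ν _) (fun _ => h01 _) (fun _ => h01 _)
      (sparreAndersen ν isHalfLine_Ioi) hs
    have h3 : Summable fun m => (iidLaw ν).real (returnBelow m) * s ^ m :=
      summable_mul_pow_of_bounded (fun _ => h01 _) hs
    have h4 : Summable fun m => (iidLaw ν).real (ladderAt (Ioi 0) m) * s ^ m :=
      summable_mul_pow_of_bounded (fun _ => h01 _) hs
    have h5 : Summable fun m => (iidLaw ν).real (ladderAt (Ici 0) m) * s ^ m :=
      summable_mul_pow_of_bounded (fun _ => h01 _) hs
    have h6 : ∑' m, (iidLaw ν).real (ladderAt (Ici 0) m) * s ^ m ≤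
        (∑' m, (iidLaw ν).real (ladderAt (Ioi 0) m) * s ^ m) *
          ∑' m, (iidLaw ν).real (returnBelow m) * s ^ m := by
      rw [tsum_mul_tsum_eq_tsum_sum_range_of_summable_norm h4.norm h3.norm]
      refine h5.tsum_le_tsum (fun m => ?_)
        (summable_norm_sum_mul_range_of_summable_norm h4.norm h3.norm).of_norm
      refine (mul_le_mul_of_nonneg_right (real_ladderAt_Ici_le ν m) (by positivity)).trans_eq ?_
      rw [Finset.sum_mul]
      refine Finset.sum_congr rfl fun k hk => ?_
      have hk := Finset.mem_range.1 hk
      rw [show s ^ m = s ^ k * s ^ (m - k) by rw [← pow_add]; congr 1; omega]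
      ring
    have h7 : ∑' m, (iidLaw ν).real (returnBelow m) * s ^ m ≤
        ∑' m, (iidLaw ν).real (returnBelow m) :=
      h3.tsum_le_tsum (fun m => mul_le_of_le_one_right measureReal_nonneg
        (pow_le_one₀ hs0.le hs1.le)) hv
    rw [h1, h2] at h6
    have h8 := (div_le_iff₀' (Real.exp_pos _)).2 h6
    rw [← Real.exp_sub, ← (hb _).tsum_sub (hb _)] at h8
    have h9 : ∀ k : ℕ, (iidLaw ν).real {x | psum x (k + 1) ∈ Ici 0} / (k + 1) * s ^ (k + 1) -
        (iidLaw ν).real {x | psum x (k + 1) ∈ Ioi 0} / (k + 1) * s ^ (k + 1) =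
        1 / ((k : ℝ) + 1) * (iidLaw ν).real {x | psum x (k + 1) = 0} * s ^ (k + 1) := by
      intro k
      rw [real_psum_mem_Ici]
      ring
    have h10 := (hb (Ici 0)).sub (hb (Ioi 0))
    simp only [h9] at h8 h10
    have h11 := h8.trans h7
    refine (h10.sum_le_tsum (Finset.range n) fun k _ => by positivity).trans ?_
    rwa [Real.le_log_iff_exp_le ((Real.exp_pos _).trans_le h11)]
  refine summable_of_sum_range_le
    (c := Real.log (∑' m, (iidLaw ν).real (returnBelow m))) (fun k => by positivity) fun n => ?_
  have hcont : Continuous fun s : ℝ => ∑ k ∈ Finset.range n, 1 / ((k : ℝ) + 1) *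
        (iidLaw ν).real {x | psum x (k + 1) = 0} * s ^ (k + 1) := by fun_prop
  have hlim := (hcont.tendsto 1).mono_left (nhdsWithin_le_nhds (s := Iio 1))
  simp only [one_pow, mul_one] at hlim
  refine le_of_tendsto hlim ?_
  filter_upwards [Ioo_mem_nhdsLT (show (0 : ℝ) < 1 by norm_num)] with s hs
  exact hmain s hs.1 hs.2 n

lemma psum_neg (x : ℕ → ℝ) (n : ℕ) : psum (fun i => -x i) n = -psum x n :=
  Finset.sum_neg_distrib _

/-- If positive steps have probability zero, negative ones do not, and changing the sign of all
steps preserves S_k = 0. -/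
theorem summable_real_psum_eq_zero (hν : ν {0}ᶜ ≠ 0) :
    Summable fun k : ℕ => 1 / ((k : ℝ) + 1) * (iidLaw ν).real {x | psum x (k + 1) = 0} := by
  by_cases hpos : 0 < ν.real (Ioi 0)
  · exact summable_real_psum_eq_zero_of_pos ν hpos
  · have hneg : 0 < ν.real (Iio 0) := by
      by_contra hneg
      have h1 : ν (Ioi 0) = 0 := by
        have := le_antisymm (not_lt.1 hpos) measureReal_nonneg
        rwa [measureReal_eq_zero_iff] at this
      have h2 : ν (Iio 0) = 0 := by
        have := le_antisymm (not_lt.1 hneg) measureReal_nonneg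
        rwa [measureReal_eq_zero_iff] at this
      refine hν ?_
      rw [← Iio_union_Ioi]
      exact measure_union_null h2 h1
    have : IsProbabilityMeasure (ν.map fun y => -y) :=
      Measure.isProbabilityMeasure_map measurable_neg.aemeasurable
    have hmap : (iidLaw ν).map (fun x i => -x i) = iidLaw (ν.map fun y => -y) :=
      Measure.infinitePi_map_pi (fun _ : ℕ => ν) (f := fun _ y => -y) fun _ => measurable_neg
    have hpos' : 0 < (ν.map fun y => -y).real (Ioi 0) := by
      rw [map_measureReal_apply measurable_neg measurableSet_Ioi]
      simpa using hneg
    refine (summable_real_psum_eq_zero_of_pos _ hpos').congr fun k => ?_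
    rw [← hmap, map_measureReal_apply (by fun_prop)
      (measurableSet_eq_fun (measurable_psum _) measurable_const)]
    simp only [preimage_ofPred_eq, psum_neg, neg_eq_zero]

/-- The law of the difference of two independent variables with law `ν`. -/
noncomputable def diffLaw : Measure ℝ := (ν.prod ν).map fun p => p.1 - p.2

instance : IsProbabilityMeasure (diffLaw ν) :=
  Measure.isProbabilityMeasure_map (by fun_prop)

lemma diffLaw_compl_zero_ne (hν : ∀ c, ν {c}ᶜ ≠ 0) : diffLaw ν {0}ᶜ ≠ 0 := by
  intro h
  have hm : Measurable fun p : ℝ × ℝ => p.1 - p.2 := by fun_prop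
  rw [diffLaw, Measure.map_apply hm (measurableSet_singleton 0).compl,
    Measure.measure_prod_null (hm (measurableSet_singleton 0).compl)] at h
  obtain ⟨c, hc⟩ := h.exists
  refine hν c ?_
  convert! hc using 2
  ext y
  simp [sub_eq_zero, eq_comm]

lemma map_sub_infinitePi_prod_bool :
    (Measure.infinitePi fun _ : ℕ × Bool => ν).map (fun x i => x (i, true) - x (i, false)) =
      iidLaw (diffLaw ν) := by
  have h1 := Measure.infinitePi_map_curry (fun (_ : ℕ) (_ : Bool) => ν)
  have h2 : (Measure.infinitePi fun _ : Bool => ν).map (fun p => p true - p false) =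
      diffLaw ν := by
    rw [diffLaw, ← Measure.infinitePi_map_eval_prod (P := fun _ : Bool => ν) (i := true)
      (j := false) (by simp), Measure.map_map (by fun_prop) (by fun_prop)]
    rfl
  have h3 := Measure.infinitePi_map_pi (fun _ : ℕ => Measure.infinitePi fun _ : Bool => ν)
    (f := fun _ p => p true - p false) fun _ => by fun_prop
  simp only [h2] at h3
  rw [← h1, Measure.map_map (by fun_prop) (by fun_prop)] at h3
  exact h3

lemma psum_sub (x y : ℕ → ℝ) (n : ℕ) : psum (fun i => x i - y i) n = psum x n - psum y n :=
  Finset.sum_sub_distrib _ _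

/-- If two independent copies of the walk are both at c, their difference, a walk with step law
`diffLaw ν`, is at 0. -/
lemma sq_real_psum_eq_le (m : ℕ) (c : ℝ) :
    (iidLaw ν).real {x | psum x m = c} ^ 2 ≤
      (iidLaw (diffLaw ν)).real {x | psum x m = 0} := by
  have hm : ∀ c, MeasurableSet {x | psum x m = c} := fun c =>
    measurableSet_eq_fun (measurable_psum _) measurable_const
  have hind := indepFun_comp_of_disjoint_range ν (fun i : ℕ => (i, true)) (fun i : ℕ => (i, false))
    (by
      rw [Set.disjoint_left]
      rintro _ ⟨a, rfl⟩ ⟨b, hb⟩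
      simp at hb)
  have h1 := IndepFun.real_inter_preimage hind (hm c) (hm c)
  have hinj : ∀ b : Bool, Function.Injective fun i : ℕ => (i, b) := fun b i j h => by
    simpa using h
  have h2 : ∀ b : Bool, (Measure.infinitePi fun _ : ℕ × Bool => ν).real
      ((fun x i => x (i, b)) ⁻¹' {x | psum x m = c}) = (iidLaw ν).real {x | psum x m = c} := by
    intro b
    rw [← map_measureReal_apply (by fun_prop) (hm c), map_reindex_infinitePi ν (hinj b)]
  rw [h2, h2, ← pow_two] at h1
  rw [← h1, ← map_sub_infinitePi_prod_bool, map_measureReal_apply (by fun_prop) (hm 0)]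
  refine measureReal_mono ?_
  rintro x ⟨hx1, hx2⟩
  simp only [mem_preimage, mem_ofPred_eq] at hx1 hx2 ⊢
  rw [psum_sub, hx1, hx2, sub_self]

/-- Given that the last d steps add up to y, S_{m+d} = 0 forces S_m = -y, an event of probability at
most `C`. -/
lemma real_psum_add_eq_zero_le {m : ℕ} {C : ℝ}
    (hC : ∀ c, (iidLaw ν).real {x | psum x m = c} ≤ C) (d : ℕ) :
    (iidLaw ν).real {x | psum x (m + d) = 0} ≤ C := by
  have hC0 : 0 ≤ C := measureReal_nonneg.trans (hC 0)
  have hind := indepFun_comp_of_disjoint_range ν (fun i : Fin m => (i : ℕ)) (fun i : ℕ => i + m)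
    (by
      rw [Set.disjoint_left]
      rintro _ ⟨a, rfl⟩ ⟨b, hb⟩
      have := a.2
      simp only at hb
      omega)
  have hind' : IndepFun (fun x => psum x m) (fun x => psum (fun i => x (i + m)) d)
      (iidLaw ν) := by
    have h1 := hind.comp (φ := fun y : Fin m → ℝ => ∑ i, y i) (ψ := fun y => psum y d)
      (by fun_prop) (by fun_prop)
    convert! h1 using 1
    ext x
    simp [psum, Finset.sum_range]
  have hsm : Measurable fun x : ℕ → ℝ => psum (fun i => x (i + m)) d :=
    (measurable_psum d).comp (by fun_prop)
  have hprod := (indepFun_iff_map_prod_eq_prod_map_map (measurable_psum m).aemeasurable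
    hsm.aemeasurable).1 hind'
  have hms : MeasurableSet {p : ℝ × ℝ | p.1 + p.2 = 0} :=
    measurableSet_eq_fun (by fun_prop) measurable_const
  have h2 : (iidLaw ν) {x | psum x (m + d) = 0} =
      (((iidLaw ν).map fun x => psum x m).prod
        ((iidLaw ν).map fun x => psum (fun i => x (i + m)) d)) {p : ℝ × ℝ | p.1 + p.2 = 0} := by
    rw [← hprod, Measure.map_apply ((measurable_psum m).prodMk hsm) hms]
    congr 1
    ext x
    simp [psum_shift]
  have : IsProbabilityMeasure ((iidLaw ν).map fun x => psum (fun i => x (i + m)) d) :=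
    Measure.isProbabilityMeasure_map hsm.aemeasurable
  have : IsProbabilityMeasure ((iidLaw ν).map fun x => psum x m) :=
    Measure.isProbabilityMeasure_map (measurable_psum m).aemeasurable
  have h3 : (iidLaw ν) {x | psum x (m + d) = 0} ≤ ENNReal.ofReal C := by
    rw [h2, Measure.prod_apply_symm hms]
    calc _ ≤ ∫⁻ _, ENNReal.ofReal C ∂((iidLaw ν).map fun x => psum (fun i => x (i + m)) d) := by
          refine lintegral_mono fun y => ?_
          have h4 := hC (-y)
          rw [measureReal_def, ← ENNReal.le_ofReal_iff_toReal_le (measure_ne_top _ _) hC0] at h4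
          rw [Measure.map_apply (measurable_psum m) (measurable_prodMk_right hms)]
          convert! h4 using 3
          ext x
          simp [eq_neg_iff_add_eq_zero]
      _ = ENNReal.ofReal C := by simp
  rwa [measureReal_def, ← ENNReal.le_ofReal_iff_toReal_le (measure_ne_top _ _) hC0]

/-- The symmetrized walk has summable P(S_k = 0)/k, so by divergence of the harmonic series some
P(S_k = 0) is arbitrarily small. This bounds all atoms of the original S_k, and the bound persists
at later times. -/
theorem tendsto_real_psum_eq_zero (hν : ∀ c, ν {c}ᶜ ≠ 0) :
    Tendsto (fun n => (iidLaw ν).real {x | psum x n = 0}) atTop (𝓝 0) := by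
  have hs := summable_real_psum_eq_zero (diffLaw ν) (diffLaw_compl_zero_ne ν hν)
  rw [Metric.tendsto_atTop]
  intro ε hε
  obtain ⟨k, hk⟩ : ∃ k : ℕ,
      (iidLaw (diffLaw ν)).real {x | psum x (k + 1) = 0} < (ε / 2) ^ 2 := by
    by_contra! hcon
    have h1 : Summable fun k : ℕ => (ε / 2) ^ 2 * (1 / ((k : ℝ) + 1)) :=
      Summable.of_nonneg_of_le (fun k => by positivity)
        (fun k => by
          rw [mul_comm]
          exact mul_le_mul_of_nonneg_left (hcon k) (by positivity)) hs
    rw [summable_mul_left_iff (by positivity)] at h1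
    refine Real.not_summable_one_div_natCast ((summable_nat_add_iff 1).1 (h1.congr fun n => ?_))
    push_cast
    rfl
  refine ⟨k + 1, fun n hn => ?_⟩
  obtain ⟨d, rfl⟩ := Nat.exists_eq_add_of_le hn
  have h2 := real_psum_add_eq_zero_le ν (m := k + 1) (C := ε / 2) (fun c =>
    le_of_sq_le_sq ((sq_real_psum_eq_le ν (k + 1) c).trans hk.le) (by positivity)) d
  rw [Real.dist_eq, sub_zero, abs_of_nonneg measureReal_nonneg]
  linarith

end zero

/-! ### Maximum positions and counts as path events -/

lemma nonempty_maxPositions (s : ℕ → ℝ) (n : ℕ) : (maxPositions s n).Nonempty := by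
  obtain ⟨k, hk, hmax⟩ := Finset.exists_max_image (Finset.range (n + 1)) s ⟨0, by simp⟩
  exact ⟨k, Nat.lt_succ_iff.1 (Finset.mem_range.1 hk), fun j hj =>
    hmax j (Finset.mem_range.2 (Nat.lt_succ_iff.2 hj))⟩

lemma lastMaxPos_eq_iff {Ω : Type*} (X : ℕ → Ω → ℝ) (n : ℕ) (ω : Ω) :
    lastMaxPos X n ω = n ↔ (fun i => X i ω) ∈ ladderAt (Ici 0) n := by
  have hbdd : BddAbove (maxPositions (fun k => walk X k ω) n) := ⟨n, fun k hk => hk.1⟩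
  have hne := nonempty_maxPositions (fun k => walk X k ω) n
  constructor
  · intro h j hj
    have := Nat.sSup_mem hne hbdd
    rw [show sSup (maxPositions (fun k => walk X k ω) n) = n from h] at this
    exact sub_nonneg.2 (this.2 j hj.le)
  · intro h
    refine le_antisymm (csSup_le hne fun k hk => hk.1) (le_csSup hbdd ⟨le_rfl, fun j hj => ?_⟩)
    rcases hj.lt_or_eq with hj | rfl
    · exact sub_nonneg.1 (h j hj)
    · exact le_rfl

lemma firstMaxPos_eq_iff {Ω : Type*} (X : ℕ → Ω → ℝ) (n : ℕ) (ω : Ω) :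
    firstMaxPos X n ω = n ↔ (fun i => X i ω) ∈ ladderAt (Ioi 0) n := by
  have hne := nonempty_maxPositions (fun k => walk X k ω) n
  constructor
  · intro h j hj
    have hmem := Nat.sInf_mem hne
    have hmin : ∀ k ∈ maxPositions (fun k => walk X k ω) n, n ≤ k := fun k hk =>
      h.symm.le.trans (Nat.sInf_le hk)
    rw [show sInf (maxPositions (fun k => walk X k ω) n) = n from h] at hmem
    refine sub_pos.2 (lt_of_not_ge fun hle : walk X n ω ≤ walk X j ω => ?_)
    have := hmin j ⟨hj.le, fun i hi => (hmem.2 i hi).trans hle⟩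
    omega
  · intro h
    have hmem : n ∈ maxPositions (fun k => walk X k ω) n := ⟨le_rfl, fun j hj => by
      rcases hj.lt_or_eq with hj | rfl
      · exact (sub_pos.1 (h j hj)).le
      · exact le_rfl⟩
    refine le_antisymm (Nat.sInf_le hmem) (le_csInf hne fun k hk => ?_)
    by_contra! hkn
    exact absurd (hk.2 n le_rfl) (not_le.2 (sub_pos.1 (h k hkn)))

lemma numNonneg_eq_iff {Ω : Type*} (X : ℕ → Ω → ℝ) (n : ℕ) (ω : Ω) :
    numNonneg X n ω = n ↔ (fun i => X i ω) ∈ stayUpTo (Ici 0) n := by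
  have h := Finset.card_filter_eq_iff (s := Finset.Icc 1 n) (p := fun i => 0 ≤ walk X i ω)
  rw [Nat.card_Icc, Nat.add_sub_cancel] at h
  exact h.trans ⟨fun h j h1 h2 => h _ (Finset.mem_Icc.2 ⟨h1, h2⟩), fun h j hj =>
    h j (Finset.mem_Icc.1 hj).1 (Finset.mem_Icc.1 hj).2⟩

lemma numPos_eq_iff {Ω : Type*} (X : ℕ → Ω → ℝ) (n : ℕ) (ω : Ω) :
    numPos X n ω = n ↔ (fun i => X i ω) ∈ stayUpTo (Ioi 0) n := by
  have h := Finset.card_filter_eq_iff (s := Finset.Icc 1 n) (p := fun i => 0 < walk X i ω)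
  rw [Nat.card_Icc, Nat.add_sub_cancel] at h
  exact h.trans ⟨fun h j h1 h2 => h _ (Finset.mem_Icc.2 ⟨h1, h2⟩), fun h j hj =>
    h j (Finset.mem_Icc.1 hj).1 (Finset.mem_Icc.1 hj).2⟩

end RecordWalk

/-! ### Transfer to the given random variables -/

open RecordWalk in
theorem mainTheorem2 {Ω : Type*} [MeasurableSpace Ω] (P : MeasureTheory.Measure Ω)
    [MeasureTheory.IsProbabilityMeasure P] (X : ℕ → Ω → ℝ)
    (hmeas : ∀ i, Measurable (X i))
    (hindep : ProbabilityTheory.iIndepFun X P)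
    (hident : ∀ i, ProbabilityTheory.IdentDistrib (X i) (X 0) P P)
    (hnondeg : ¬ ∃ c : ℝ, ∀ᵐ ω ∂P, X 0 ω = c) :
    (∀ n : ℕ, P.real {ω | RecordWalk.lastMaxPos X n ω = n}
        = P.real {ω | RecordWalk.numNonneg X n ω = n}) ∧
    (∀ n : ℕ, P.real {ω | RecordWalk.firstMaxPos X n ω = n}
        = P.real {ω | RecordWalk.numPos X n ω = n}) ∧
    (∀ ρ : ℝ, 0 < ρ → ρ ≤ 1 →
      Filter.Tendsto (fun n : ℕ => P.real {ω | 0 ≤ RecordWalk.walk X n ω})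
        Filter.atTop (nhds ρ) →
      Asymptotics.IsEquivalent Filter.atTop
        (fun n : ℕ => P.real {ω | RecordWalk.numNonneg X n ω = n})
        (fun n : ℕ => 1 / Real.Gamma ρ * (n : ℝ) ^ (ρ - 1) *
          RecordWalk.weakC P X ρ (1 - 1 / (n : ℝ))) ∧
      Asymptotics.IsEquivalent Filter.atTop
        (fun n : ℕ => P.real {ω | RecordWalk.numPos X n ω = n})
        (fun n : ℕ => 1 / Real.Gamma ρ * (n : ℝ) ^ (ρ - 1) *
          RecordWalk.strictC P X ρ (1 - 1 / (n : ℝ)))) ∧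
    (Summable (fun k : ℕ => 1 / ((k : ℝ) + 1) *
        P.real {ω | RecordWalk.walk X (k + 1) ω < 0}) →
      Filter.Tendsto (fun n : ℕ => P.real {ω | RecordWalk.lastMaxPos X n ω = n})
        Filter.atTop (nhds (Real.exp (-∑' k : ℕ, 1 / ((k : ℝ) + 1) *
          P.real {ω | RecordWalk.walk X (k + 1) ω < 0}))) ∧
      Filter.Tendsto (fun n : ℕ => P.real {ω | RecordWalk.numNonneg X n ω = n})
        Filter.atTop (nhds (Real.exp (-∑' k : ℕ, 1 / ((k : ℝ) + 1) *
          P.real {ω | RecordWalk.walk X (k + 1) ω < 0}))) ∧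
      Summable (fun k : ℕ => 1 / ((k : ℝ) + 1) *
        P.real {ω | RecordWalk.walk X (k + 1) ω ≤ 0}) ∧
      Filter.Tendsto (fun n : ℕ => P.real {ω | RecordWalk.firstMaxPos X n ω = n})
        Filter.atTop (nhds (Real.exp (-∑' k : ℕ, 1 / ((k : ℝ) + 1) *
          P.real {ω | RecordWalk.walk X (k + 1) ω ≤ 0}))) ∧
      Filter.Tendsto (fun n : ℕ => P.real {ω | RecordWalk.numPos X n ω = n})
        Filter.atTop (nhds (Real.exp (-∑' k : ℕ, 1 / ((k : ℝ) + 1) *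
          P.real {ω | RecordWalk.walk X (k + 1) ω ≤ 0})))) := by
  have hν : IsProbabilityMeasure (P.map (X 0)) :=
    Measure.isProbabilityMeasure_map (hmeas 0).aemeasurable
  set ν := P.map (X 0) with hνdef
  have hlaw : P.map (fun ω i => X i ω) = iidLaw ν := by
    rw [(iIndepFun_iff_map_fun_eq_infinitePi_map hmeas).1 hindep]
    simp only [fun i => (hident i).map_eq, hνdef]
  have htr : ∀ A : Set (ℕ → ℝ), MeasurableSet A →
      P.real {ω | (fun i => X i ω) ∈ A} = (iidLaw ν).real A := by
    intro A hA
    rw [← hlaw, map_measureReal_apply (by fun_prop) hA]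
    rfl
  have hnd : ∀ c, ν {c}ᶜ ≠ 0 := by
    intro c hc
    refine hnondeg ⟨c, ?_⟩
    rw [hνdef, Measure.map_apply (hmeas 0) (measurableSet_singleton c).compl] at hc
    exact hc
  have hlast : ∀ n : ℕ, P.real {ω | lastMaxPos X n ω = n} =
      (iidLaw ν).real (ladderAt (Ici 0) n) := fun n => by
    simp only [lastMaxPos_eq_iff]
    exact htr _ (measurableSet_ladderAt measurableSet_Ici n)
  have hfirst : ∀ n : ℕ, P.real {ω | firstMaxPos X n ω = n} =
      (iidLaw ν).real (ladderAt (Ioi 0) n) := fun n => by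
    simp only [firstMaxPos_eq_iff]
    exact htr _ (measurableSet_ladderAt measurableSet_Ioi n)
  have hnonneg : ∀ n : ℕ, P.real {ω | numNonneg X n ω = n} =
      (iidLaw ν).real (ladderAt (Ici 0) n) := fun n => by
    simp only [numNonneg_eq_iff]
    rw [htr _ (measurableSet_stayUpTo measurableSet_Ici n),
      real_ladderAt_eq_real_stayUpTo ν measurableSet_Ici]
  have hpos : ∀ n : ℕ, P.real {ω | numPos X n ω = n} =
      (iidLaw ν).real (ladderAt (Ioi 0) n) := fun n => by
    simp only [numPos_eq_iff]
    rw [htr _ (measurableSet_stayUpTo measurableSet_Ioi n),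
      real_ladderAt_eq_real_stayUpTo ν measurableSet_Ioi]
  have hge : ∀ n, P.real {ω | 0 ≤ walk X n ω} = (iidLaw ν).real {x | psum x n ∈ Ici 0} :=
    fun n => htr _ (measurableSet_psum_mem measurableSet_Ici n)
  have hgt : ∀ n, P.real {ω | 0 < walk X n ω} = (iidLaw ν).real {x | psum x n ∈ Ioi 0} :=
    fun n => htr _ (measurableSet_psum_mem measurableSet_Ioi n)
  have hcompl : ∀ A : Set (ℕ → ℝ), MeasurableSet A →
      (iidLaw ν).real Aᶜ = 1 - (iidLaw ν).real A := fun A hA => by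
    rw [measureReal_compl hA, probReal_univ]
  have hlt : ∀ n, P.real {ω | walk X n ω < 0} = 1 - (iidLaw ν).real {x | psum x n ∈ Ici 0} := by
    intro n
    rw [← hcompl _ (measurableSet_psum_mem measurableSet_Ici n),
      ← htr _ (measurableSet_psum_mem measurableSet_Ici n).compl]
    congr 1
    ext ω
    exact (not_le (a := 0) (b := walk X n ω)).symm
  have hle : ∀ n, P.real {ω | walk X n ω ≤ 0} = 1 - (iidLaw ν).real {x | psum x n ∈ Ioi 0} := by
    intro n
    rw [← hcompl _ (measurableSet_psum_mem measurableSet_Ioi n),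
      ← htr _ (measurableSet_psum_mem measurableSet_Ioi n).compl]
    congr 1
    ext ω
    exact (not_lt (a := 0) (b := walk X n ω)).symm
  have habs : ∀ A : Set (ℕ → ℝ), |(iidLaw ν).real A| ≤ 1 := fun A => by
    rw [abs_of_nonneg measureReal_nonneg]
    exact measureReal_le_one
  refine ⟨fun n => by rw [hlast, hnonneg], fun n => by rw [hfirst, hpos], ?_, ?_⟩
  · intro ρ hρ _ hlim
    simp only [hge] at hlim
    -- Since P(S_n = 0) → 0, the strict probabilities have the same limit ρ.
    have hlim' : Tendsto (fun n => (iidLaw ν).real {x | psum x n ∈ Ioi 0}) atTop (𝓝 ρ) := by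
      have := hlim.sub (tendsto_real_psum_eq_zero ν hnd)
      rw [sub_zero] at this
      refine this.congr fun n => ?_
      rw [real_psum_mem_Ici, add_sub_cancel_right]
    simp only [hnonneg, hpos, weakC, strictC, hge, hgt]
    exact ⟨isEquivalent_of_recursion (real_ladderAt_zero ν _) (fun _ => measureReal_nonneg)
        (antitone_real_ladderAt ν measurableSet_Ici) (fun _ => measureReal_nonneg)
        (fun _ => measureReal_le_one) (sparreAndersen ν isHalfLine_Ici) hρ
        (hlim.comp (tendsto_add_atTop_nat 1)),
      isEquivalent_of_recursion (real_ladderAt_zero ν _) (fun _ => measureReal_nonneg)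
        (antitone_real_ladderAt ν measurableSet_Ioi) (fun _ => measureReal_nonneg)
        (fun _ => measureReal_le_one) (sparreAndersen ν isHalfLine_Ioi) hρ
        (hlim'.comp (tendsto_add_atTop_nat 1))⟩
  · intro hsum
    simp only [hlt] at hsum
    -- P(S_k ≤ 0) is P(S_k < 0) + P(S_k = 0), and both weighted series converge.
    have hsum' : Summable fun k : ℕ => 1 / ((k : ℝ) + 1) *
        (1 - (iidLaw ν).real {x | psum x (k + 1) ∈ Ioi 0}) := by
      refine (hsum.add (summable_real_psum_eq_zero ν (hnd 0))).congr fun k => ?_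
      rw [real_psum_mem_Ici]
      ring
    have h1 := tendsto_exp_neg_tsum (real_ladderAt_zero ν _) (fun _ => habs _)
      (antitone_real_ladderAt ν measurableSet_Ici) (fun _ => habs _)
      (sparreAndersen ν isHalfLine_Ici) hsum
    have h2 := tendsto_exp_neg_tsum (real_ladderAt_zero ν _) (fun _ => habs _)
      (antitone_real_ladderAt ν measurableSet_Ioi) (fun _ => habs _)
      (sparreAndersen ν isHalfLine_Ioi) hsum'
    simp only [hlast, hfirst, hnonneg, hpos, hlt, hle]
    exact ⟨h1, h1, hsum', h2, h2⟩
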